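/- Let $(X_t,\sigma_t)_{t\in\mathbb Z}$ be a stochastic volatility model with Gamma-type log-volatility, that is, almost surely $$X_t=\sigma_t\epsilon_t,\qquad \sigma_t>0,\qquad \log\sigma_t=\sum_{i=0}^\infty \alpha_i\eta_{t-i},\qquad t\in\mathbb Z,$$ where * $\alpha_i\in[0,1]$, $\max_{i\ge 0}\alpha_i=1$ and $\alpha_i=O(i^{-\theta})$ as $i\to\infty$ for some $\theta>1$; * $(\eta_t)_{t\in\mathbb Z}$ are i.i.d. real random variables with $E(\eta_0^2)<\infty$ and $P(\eta_0>z)\sim Kz^\beta e^{-z}$ as $z\to\infty$ for some $K>0$ and some real $\beta\ne-1$; * $(\epsilon_t)_{t\in\mathbb Z}$ are i.i.d. real random variables, the sequence being independent of $(\eta_t)_{t\in\mathbb Z}$, with $P(\epsilon_0>0)>0$ and $E(|\epsilon_0|^{1+\delta})<\infty$ for some $\delta>0$. Assume that $(\alpha_i)_{i\ge 0}$ is strictly decreasing, and let $h\ge 1$ be an integer. Then $\alpha_0=1$, and the linear program $$\text{minimize }\ \sum_{i=0}^\infty\kappa_i\quad\text{subject to}\quad \sum_{i=h}^\infty\alpha_{i-h}\kappa_i\ge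 1,\quad \sum_{i=0}^\infty\alpha_i\kappa_i\ge 1,\quad \kappa_i\ge 0\ \text{ for all } i\ge 0$$ has the unique solution $\kappa_0=1-\alpha_h$, $\kappa_h=1$ and $\kappa_i=0$ for all other $i$. Furthermore, write $\epsilon_0^+=\max\{\epsilon_0,0\}$. If $E\big((\epsilon_0^+)^{2-\alpha_h+\delta}\big)<\infty$ for some $\delta>0$, then for all $s_0,s_h>0$ $$\lim_{x\to\infty}\frac{P(\sigma_0>s_0x,\ \sigma_h>s_hx)}{P(\min\{\sigma_0,\sigma_h\}>x)}=\lim_{x\to\infty}\frac{P(X_0>s_0x,\ X_h>s_hx)}{P(\min\{X_0,X_h\}>x)}=s_0^{\alpha_h-1}s_h^{-1},$$ and both $(\sigma_0,\sigma_h)$ and $(X_0,X_h)$ have coefficient of tail dependence $1/(2-\alpha_h)$. Here a random vector $(Y_0,Y_1)$ with identically distributed components and common quantile function $F^{\leftarrow}(p)=\inf\{y: P(Y_0\le y)\ge p\}$ has coefficient of tail dependence $c>0$ if $f(x)=P\big(Y_0>F^{\leftarrow}(1-1/x),\,Y_1>F^{\leftarrow}(1-1/x)\big)$ is regularly varying at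 infinity with index $-1/c$, that is, $f$ is measurable and positive on some half-line $(A,\infty)$ and $f(sx)/f(x)\to s^{-1/c}$ as $x\to\infty$ for every $s>0$. -/

import Mathlib

open MeasureTheory ProbabilityTheory Filter Set
open scoped Topology ENNReal

noncomputable section

/-- `(X_t, σ_t)`, `t ∈ ℤ`, is a stochastic volatility model with Gamma-type log-volatility, with
coefficients `α_i`, `i ∈ ℕ₀`, log-volatility innovations `η_t` and return innovations `ε_t`.
Measurability of `σ_t` and `X_t` (up to null sets) follows from the two defining equations. -/
structure IsGammaTypeSVModel {Ω : Type*} [MeasurableSpace Ω] (μ : Measure Ω)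
    (α : ℕ → ℝ) (η ε σ X : ℤ → Ω → ℝ) : Prop where
  coeff_mem : ∀ i, α i ∈ Icc (0 : ℝ) 1
  coeff_max : IsGreatest (range α) 1
  coeff_decay : ∃ θ : ℝ, 1 < θ ∧ α =O[atTop] fun i : ℕ => (i : ℝ) ^ (-θ)
  measurable_eta : ∀ t, Measurable (η t)
  indep_eta : iIndepFun η μ
  identDistrib_eta : ∀ t, IdentDistrib (η t) (η 0) μ μ
  eta_sq : Integrable (fun ω => η 0 ω ^ 2) μ
  eta_tail : ∃ K β : ℝ, 0 < K ∧ β ≠ -1 ∧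
    Asymptotics.IsEquivalent atTop (fun z : ℝ => μ.real {ω | z < η 0 ω})
      (fun z : ℝ => K * z ^ β * Real.exp (-z))
  measurable_eps : ∀ t, Measurable (ε t)
  indep_eps : iIndepFun ε μ
  identDistrib_eps : ∀ t, IdentDistrib (ε t) (ε 0) μ μ
  eps_pos : 0 < μ {ω | 0 < ε 0 ω}
  eps_moment : ∃ δ : ℝ, 0 < δ ∧ Integrable (fun ω => |ε 0 ω| ^ (1 + δ)) μ
  indep_eta_eps : IndepFun (fun ω t => η t ω) (fun ω t => ε t ω) μ
  vol_pos : ∀ t, ∀ᵐ ω ∂μ, 0 < σ t ω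
  log_vol : ∀ t, ∀ᵐ ω ∂μ,
    Tendsto (fun n : ℕ => ∑ i ∈ Finset.range n, α i * η (t - (i : ℤ)) ω) atTop
      (𝓝 (Real.log (σ t ω)))
  return_eq : ∀ t, ∀ᵐ ω ∂μ, X t ω = σ t ω * ε t ω

/-- The constraints `∑_{i ≥ h} α_{i-h} κ_i ≥ 1`, `∑_{i ≥ 0} α_i κ_i ≥ 1`, `κ_i ≥ 0` of the linear
program at lag `h`. The sums of nonnegative terms are taken in `[0, ∞]`. -/
structure LagLPFeasible (α : ℕ → ℝ) (h : ℕ) (κ : ℕ → ℝ) : Prop where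
  nonneg : ∀ i, 0 ≤ κ i
  shifted : 1 ≤ ∑' i : ℕ, ENNReal.ofReal (α i * κ (i + h))
  unshifted : 1 ≤ ∑' i : ℕ, ENNReal.ofReal (α i * κ i)

/-- The objective `∑_{i ≥ 0} κ_i ∈ [0, ∞]` of the linear program. -/
def lagLPObjective (κ : ℕ → ℝ) : ℝ≥0∞ := ∑' i : ℕ, ENNReal.ofReal (κ i)

/-- `κ` is a solution (a minimizer) of the linear program at lag `h`. -/
def IsLagLPSolution (α : ℕ → ℝ) (h : ℕ) (κ : ℕ → ℝ) : Prop :=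
  LagLPFeasible α h κ ∧
    ∀ κ' : ℕ → ℝ, LagLPFeasible α h κ' → lagLPObjective κ ≤ lagLPObjective κ'

/-- `f` is regularly varying at `∞` with index `ρ`: it is measurable and positive on some
`(A, ∞)`, and `f (s x) / f x → s ^ ρ` as `x → ∞` for every `s > 0`. -/
def RegularlyVarying (f : ℝ → ℝ) (ρ : ℝ) : Prop :=
  (∃ A : ℝ, (Measurable fun x : Ioi A => f x) ∧ ∀ x, A < x → 0 < f x) ∧
    ∀ s : ℝ, 0 < s → Tendsto (fun x => f (s * x) / f x) atTop (𝓝 (s ^ ρ))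

/-- The quantile function `F^←(p) = inf {y | F y ≥ p}` of a probability law on `ℝ` with
distribution function `F`, used for `p ∈ (0, 1)`. -/
def quantile (ν : Measure ℝ) (p : ℝ) : ℝ := sInf {y : ℝ | p ≤ cdf ν y}

/-- `(Y₀, Y₁)` has equal marginal laws, with quantile function `F^←`, and coefficient of tail
dependence `c`: the function `x ↦ P(Y₀ > F^←(1 - 1/x), Y₁ > F^←(1 - 1/x))` is regularly varying
with index `-1/c`. -/
def HasTailDependenceCoeff {Ω : Type*} [MeasurableSpace Ω] (μ : Measure Ω)
    (Y₀ Y₁ : Ω → ℝ) (c : ℝ) : Prop :=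
  0 < c ∧ IdentDistrib Y₀ Y₁ μ μ ∧
    RegularlyVarying
      (fun x => μ.real {ω | quantile (μ.map Y₀) (1 - 1 / x) < Y₀ ω ∧
        quantile (μ.map Y₀) (1 - 1 / x) < Y₁ ω})
      (-(1 / c))

end

/-! ### The linear program, by duality and complementary slackness. -/

section LinearProgram

variable {α : ℕ → ℝ} {h : ℕ}

/-- The basic feasible point of the linear program at lag `h` supported on `{0, h}`. -/
def lagLPPoint (α : ℕ → ℝ) (h : ℕ) (i : ℕ) : ℝ :=
  if i = 0 then 1 - α h else if i = h then 1 else 0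

/-- The coefficients of the combination of the two constraints of the linear program with the dual
multipliers `1 - α h` and `1`. -/
def lagLPDual (α : ℕ → ℝ) (h i : ℕ) : ℝ :=
  α i + (1 - α h) * (if h ≤ i then α (i - h) else 0)

lemma tsum_eq_of_support_pair {f : ℕ → ℝ≥0∞} (hh : 1 ≤ h)
    (hf : ∀ i, i ≠ 0 → i ≠ h → f i = 0) : ∑' i, f i = f 0 + f h := by
  have h0 : (0 : ℕ) ≠ h := by omega
  rw [tsum_eq_sum (s := {0, h}), Finset.sum_pair h0]
  intro i hi
  simp only [Finset.mem_insert, Finset.mem_singleton, not_or] at hi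
  exact hf i hi.1 hi.2

lemma tsum_add_right_eq (f : ℕ → ℝ≥0∞) (h : ℕ) :
    ∑' i, f (i + h) = ∑' i, if h ≤ i then f i else 0 := by
  rw [← ENNReal.summable.sum_add_tsum_nat_add' (k := h)
    (f := fun i => if h ≤ i then f i else 0)]
  have : ∑ i ∈ Finset.range h, (if h ≤ i then f i else 0) = 0 :=
    Finset.sum_eq_zero fun i hi => if_neg (by simpa using hi)
  simp [this]

lemma alpha_lag_lt_one (hα : StrictAnti α) (h0 : α 0 = 1) (hh : 1 ≤ h) : α h < 1 :=
  h0 ▸ hα (by omega : 0 < h)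

lemma lagLPObjective_point (hα : StrictAnti α) (h0 : α 0 = 1) (hh : 1 ≤ h) :
    lagLPObjective (lagLPPoint α h) = ENNReal.ofReal (2 - α h) := by
  have ha := alpha_lag_lt_one hα h0 hh
  have hne : h ≠ 0 := by omega
  rw [lagLPObjective, tsum_eq_of_support_pair hh]
  · rw [← ENNReal.ofReal_add] <;> simp [lagLPPoint, hne, ha.le]
    congr 1; ring
  · intro i h1 h2
    simp [lagLPPoint, h1, h2]

section

variable (hα : StrictAnti α) (hm : ∀ i, α i ∈ Icc (0 : ℝ) 1) (h0 : α 0 = 1) (hh : 1 ≤ h)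
include hα hm h0 hh

/-- Strict dual feasibility off {0, h}. For i > h it rests on α_i < α_h and α_{i-h} ≤ 1; for 0 < i <
h only α_i contributes. -/
lemma lagLPDual_lt_one {i : ℕ} (hi0 : i ≠ 0) (hih : i ≠ h) : lagLPDual α h i < 1 := by
  have ha := alpha_lag_lt_one hα h0 hh
  unfold lagLPDual
  split_ifs with hi
  · have h1 : α i < α h := hα (by omega)
    nlinarith [(hm (i - h)).2]
  · have : α i < 1 := h0 ▸ hα (by omega : 0 < i)
    linarith

lemma lagLPDual_le_one (i : ℕ) : lagLPDual α h i ≤ 1 := by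
  by_cases hi0 : i = 0
  · subst hi0
    simp [lagLPDual, h0, show ¬ h = 0 by omega]
  by_cases hih : i = h
  · subst hih
    simp [lagLPDual, h0]
  exact (lagLPDual_lt_one hα hm h0 hh hi0 hih).le

lemma lagLPPoint_feasible : LagLPFeasible α h (lagLPPoint α h) := by
  have ha := alpha_lag_lt_one hα h0 hh
  have hne : h ≠ 0 := by omega
  refine ⟨fun i => ?_, ?_, ?_⟩
  · unfold lagLPPoint
    split_ifs <;> linarith
  · refine le_trans ?_ (ENNReal.le_tsum 0)
    simp [lagLPPoint, h0, hne]
  · rw [tsum_eq_of_support_pair hh]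
    · rw [← ENNReal.ofReal_add] <;> simp [lagLPPoint, h0, hne, ha.le, (hm h).1]
    · intro i h1 h2
      simp [lagLPPoint, h1, h2]

/-- Weak duality with the slack term retained: at an optimum this term must vanish, which determines
the support of κ. Working in `ℝ≥0∞` removes all convergence questions. -/
lemma lagLPObjective_ge {κ : ℕ → ℝ} (hκ : LagLPFeasible α h κ) :
    ENNReal.ofReal (2 - α h) + ∑' i, ENNReal.ofReal ((1 - lagLPDual α h i) * κ i) ≤
      lagLPObjective κ := by
  have ha := alpha_lag_lt_one hα h0 hh
  -- Termwise, κ_i is split as its dual coefficient times κ_i plus the slack.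
  have key : lagLPObjective κ = (∑' i, ENNReal.ofReal (α i * κ i) +
      ENNReal.ofReal (1 - α h) * ∑' i, ENNReal.ofReal (α i * κ (i + h))) +
      ∑' i, ENNReal.ofReal ((1 - lagLPDual α h i) * κ i) := by
    have := tsum_add_right_eq (fun i => ENNReal.ofReal (α (i - h) * κ i)) h
    simp only [Nat.add_sub_cancel] at this
    rw [this, ← ENNReal.tsum_mul_left, ← ENNReal.tsum_add, ← ENNReal.tsum_add, lagLPObjective]
    refine tsum_congr fun i => ?_
    have h1 : 0 ≤ α i * κ i := mul_nonneg (hm i).1 (hκ.nonneg i)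
    have h2 : 0 ≤ (1 - lagLPDual α h i) * κ i :=
      mul_nonneg (sub_nonneg.2 (lagLPDual_le_one hα hm h0 hh i)) (hκ.nonneg i)
    have h3 : 0 ≤ α (i - h) * κ i := mul_nonneg (hm _).1 (hκ.nonneg i)
    have h4 : 0 ≤ 1 - α h := by linarith
    split_ifs with hi
    · rw [← ENNReal.ofReal_mul h4, ← ENNReal.ofReal_add h1 (mul_nonneg h4 h3),
        ← ENNReal.ofReal_add (by positivity) h2]
      simp only [lagLPDual, if_pos hi]
      congr 1; ring
    · rw [mul_zero, add_zero, ← ENNReal.ofReal_add h1 h2]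
      simp only [lagLPDual, if_neg hi]
      congr 1; ring
  rw [key]
  gcongr
  calc ENNReal.ofReal (2 - α h) = 1 + ENNReal.ofReal (1 - α h) * 1 := by
        rw [← ENNReal.ofReal_one, ← ENNReal.ofReal_mul (by linarith),
          ← ENNReal.ofReal_add (by norm_num) (by linarith)]
        congr 1; ring
    _ ≤ _ := by
        gcongr
        · exact hκ.unshifted
        · exact hκ.shifted

theorem isLagLPSolution_iff (κ : ℕ → ℝ) :
    IsLagLPSolution α h κ ↔ κ = lagLPPoint α h := by
  have ha := alpha_lag_lt_one hα h0 hh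
  have hne : h ≠ 0 := by omega
  constructor
  · rintro ⟨hf, hmin⟩
    have h1 := (lagLPObjective_ge hα hm h0 hh hf).trans
      (hmin _ (lagLPPoint_feasible hα hm h0 hh))
    rw [lagLPObjective_point hα h0 hh] at h1
    have h2 : ∑' i, ENNReal.ofReal ((1 - lagLPDual α h i) * κ i) = 0 := by
      have : ENNReal.ofReal (2 - α h) + ∑' i, ENNReal.ofReal ((1 - lagLPDual α h i) * κ i) ≤
          ENNReal.ofReal (2 - α h) + 0 := by simpa using h1
      simpa using (ENNReal.add_le_add_iff_left ENNReal.ofReal_ne_top).1 this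
    have hz : ∀ i, i ≠ 0 → i ≠ h → κ i = 0 := by
      intro i hi0 hih
      have h3 := ENNReal.tsum_eq_zero.1 h2 i
      rw [ENNReal.ofReal_eq_zero] at h3
      have h4 := lagLPDual_lt_one hα hm h0 hh hi0 hih
      have h5 := hf.nonneg i
      nlinarith
    have hobj : lagLPObjective κ ≤ ENNReal.ofReal (2 - α h) :=
      (hmin _ (lagLPPoint_feasible hα hm h0 hh)).trans_eq (lagLPObjective_point hα h0 hh)
    have hk0 := hf.nonneg 0
    have hkh := hf.nonneg h
    rw [lagLPObjective, tsum_eq_of_support_pair hh, ← ENNReal.ofReal_add hk0 hkh,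
      ENNReal.ofReal_le_ofReal_iff (by linarith)] at hobj
    swap
    · intro i hi0 hih; simp [hz i hi0 hih]
    have hs := hf.shifted
    rw [tsum_eq_single 0] at hs
    swap
    · intro i hi; simp [hz (i + h) (by omega) (by omega)]
    rw [zero_add, h0, one_mul, ENNReal.one_le_ofReal] at hs
    have hu := hf.unshifted
    rw [tsum_eq_of_support_pair hh, h0, one_mul,
      ← ENNReal.ofReal_add hk0 (mul_nonneg (hm h).1 hkh), ENNReal.one_le_ofReal] at hu
    swap
    · intro i hi0 hih; simp [hz i hi0 hih]
    -- What remains is κ_h ≥ 1, κ_0 + α_h κ_h ≥ 1 and κ_0 + κ_h ≤ 2 - α_h. The last two give (1 -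
    -- α_h) κ_h ≤ 1 - α_h, hence κ_h = 1.
    have e1 : κ h = 1 := by nlinarith
    have e0 : κ 0 = 1 - α h := by nlinarith
    funext i
    by_cases hi0 : i = 0
    · subst hi0; simp [lagLPPoint, e0]
    by_cases hih : i = h
    · subst hih; simp [lagLPPoint, e1, hne]
    simp [lagLPPoint, hi0, hih, hz i hi0 hih]
  · rintro rfl
    refine ⟨lagLPPoint_feasible hα hm h0 hh, fun κ' hκ' => ?_⟩
    rw [lagLPObjective_point hα h0 hh]
    exact le_self_add.trans (lagLPObjective_ge hα hm h0 hh hκ')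

end

end LinearProgram

/-! ### Gamma-type tails: ratio limit and Potter bounds. -/

section ExponentialTail

/-- The analytic properties of the tail function `m z = P(η > z)` of a Gamma-type law: it is
positive and nonincreasing, `m (u + v) / m u → exp (-v)`, and it satisfies Potter bounds. -/
structure IsExpTail (m : ℝ → ℝ) : Prop where
  antitone : Antitone m
  pos : ∀ z, 0 < m z
  ratio : ∀ v, Tendsto (fun u => m (u + v) / m u) atTop (𝓝 (Real.exp (-v)))
  potter : ∀ r : ℝ, 0 < r → ∃ C u₀ : ℝ, 0 < C ∧
    ∀ u, u₀ ≤ u → ∀ v, m (u + v) ≤ C * m u * Real.exp (-v + r * |v|)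

lemma one_add_rpow_le_exp {b r : ℝ} (hb : 0 ≤ b) (hr : 0 < r) :
    ∃ C : ℝ, 0 < C ∧ ∀ t, 0 ≤ t → (1 + t) ^ b ≤ C * Real.exp (r * t) := by
  obtain ⟨c, hc, hcb⟩ : ∃ c : ℝ, 0 < c ∧ c * b ≤ r := by
    -- The denominator b + 1 rather than b covers b = 0.
    refine ⟨r / (b + 1), by positivity, ?_⟩
    rw [div_mul_eq_mul_div, div_le_iff₀ (by positivity)]
    nlinarith
  have hM : (0 : ℝ) < 1 + c⁻¹ := by positivity
  refine ⟨(1 + c⁻¹) ^ b, by positivity, fun t ht => ?_⟩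
  have h1 : 1 + t ≤ (1 + c⁻¹) * Real.exp (c * t) := by
    have h2 := Real.add_one_le_exp (c * t)
    have h3 : (1 + c⁻¹) * (c * t + 1) = c * t + t * (c⁻¹ * c) + 1 + c⁻¹ := by ring
    rw [inv_mul_cancel₀ hc.ne'] at h3
    have h4 := mul_le_mul_of_nonneg_left h2 hM.le
    have h5 : 0 ≤ c * t := by positivity
    have h6 : 0 < c⁻¹ := by positivity
    linarith
  calc (1 + t) ^ b ≤ ((1 + c⁻¹) * Real.exp (c * t)) ^ b := by gcongr
    _ = (1 + c⁻¹) ^ b * Real.exp (c * t * b) := by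
      rw [Real.mul_rpow hM.le (Real.exp_pos _).le, ← Real.exp_mul]
    _ ≤ _ := by
      refine mul_le_mul_of_nonneg_left (Real.exp_le_exp.2 ?_) (by positivity)
      nlinarith [mul_le_mul_of_nonneg_right hcb ht]

/-- For y, z ≥ 1 each of y, z is at most the other times 1 + |y - z|; the sign of b decides which
inequality is used. -/
lemma rpow_le_rpow_mul_one_add {y z : ℝ} (hy : 1 ≤ y) (hz : 1 ≤ z) (b : ℝ) :
    y ^ b ≤ z ^ b * (1 + |y - z|) ^ |b| := by
  have habs : (0 : ℝ) ≤ |y - z| := abs_nonneg _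
  rcases le_total 0 b with hb | hb
  · rw [abs_of_nonneg hb, ← Real.mul_rpow (by linarith) (by linarith)]
    refine Real.rpow_le_rpow (by linarith) ?_ hb
    nlinarith [le_abs_self (y - z)]
  · have h1 : (y * (1 + |y - z|)) ^ b ≤ z ^ b := by
      refine Real.rpow_le_rpow_of_nonpos (by linarith) ?_ hb
      nlinarith [neg_abs_le (y - z)]
    rw [Real.mul_rpow (by linarith) (by linarith)] at h1
    rw [abs_of_nonpos hb, Real.rpow_neg (by linarith)]
    have h2 : (0 : ℝ) < (1 + |y - z|) ^ b := Real.rpow_pos_of_pos (by linarith) _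
    rwa [← div_eq_mul_inv, le_div_iff₀ h2]

lemma tendsto_gamma_ratio {K : ℝ} (hK : 0 < K) (b v : ℝ) :
    Tendsto (fun u : ℝ => (K * (u + v) ^ b * Real.exp (-(u + v))) / (K * u ^ b * Real.exp (-u)))
      atTop (𝓝 (Real.exp (-v))) := by
  have h1 : Tendsto (fun u : ℝ => 1 + v / u) atTop (𝓝 1) := by
    simpa using tendsto_const_nhds.add (tendsto_const_nhds.div_atTop tendsto_id (a := v))
  have h2 : Tendsto (fun u : ℝ => (1 + v / u) ^ b * Real.exp (-v)) atTop (𝓝 (Real.exp (-v))) := by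
    simpa using (h1.rpow_const (p := b) (Or.inl one_ne_zero)).mul_const (Real.exp (-v))
  refine h2.congr' ?_
  filter_upwards [eventually_gt_atTop 0, eventually_gt_atTop (-v)] with u hu hv
  have h3 : 1 + v / u = (u + v) / u := by field_simp
  rw [h3, Real.div_rpow (by linarith) hu.le, neg_add, Real.exp_add]
  have := Real.exp_pos (-u)
  have : 0 < u ^ b := Real.rpow_pos_of_pos hu _
  field_simp

/-- Beyond some z₀, m and K z^b e^{-z} agree up to a factor 2, and the ratio of the power factors is
absorbed in e^{r|v|}. Monotonicity carries positivity to the whole line. -/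
theorem IsExpTail.of_isEquivalent {m : ℝ → ℝ} (hanti : Antitone m) (hle : ∀ z, m z ≤ 1) {K b : ℝ}
    (hK : 0 < K) (heq : Asymptotics.IsEquivalent atTop m
      (fun z : ℝ => K * z ^ b * Real.exp (-z))) : IsExpTail m := by
  set g : ℝ → ℝ := fun z => K * z ^ b * Real.exp (-z) with hg
  have hgpos : ∀ z, 0 < z → 0 < g z := fun z hz => by
    have : 0 < z ^ b := Real.rpow_pos_of_pos hz _
    positivity
  have hlim : Tendsto (fun z => m z / g z) atTop (𝓝 1) := by
    refine (Asymptotics.isEquivalent_iff_tendsto_one ?_).1 heq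
    filter_upwards [eventually_gt_atTop 0] with z hz using (hgpos z hz).ne'
  obtain ⟨z₀, hz₀1, hz₀⟩ : ∃ z₀ : ℝ, 1 ≤ z₀ ∧ ∀ z, z₀ ≤ z → g z ≤ 2 * m z ∧ m z ≤ 2 * g z := by
    have h1 : ∀ᶠ z in atTop, (1 / 2 : ℝ) < m z / g z ∧ m z / g z < 2 :=
      (hlim.eventually (lt_mem_nhds (by norm_num))).and
        (hlim.eventually (gt_mem_nhds (by norm_num)))
    obtain ⟨w, hw⟩ := eventually_atTop.1 h1
    refine ⟨max 1 w, le_max_left _ _, fun z hz => ?_⟩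
    have hgz := hgpos z (by linarith [le_max_left 1 w])
    obtain ⟨h2, h3⟩ := hw z ((le_max_right _ _).trans hz)
    rw [lt_div_iff₀ hgz] at h2
    rw [div_lt_iff₀ hgz] at h3
    constructor <;> linarith
  have hpos : ∀ z, 0 < m z := fun z => by
    have h1 := (hz₀ (max z z₀) (le_max_right _ _)).1
    have h2 := hgpos (max z z₀) (by linarith [le_max_right z z₀])
    have h3 := hanti (le_max_left z z₀)
    linarith
  refine ⟨hanti, hpos, fun v => ?_, fun r hr => ?_⟩
  · have h1 := (hlim.comp (tendsto_atTop_add_const_right atTop v tendsto_id)).div hlim one_ne_zero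
    have h2 := h1.mul (tendsto_gamma_ratio hK b v)
    rw [div_one, one_mul] at h2
    refine h2.congr' ?_
    filter_upwards [eventually_gt_atTop 0, eventually_gt_atTop (-v)] with u hu hv
    have h3 := hgpos u hu
    have h4 := hgpos (u + v) (by linarith)
    have h5 := hpos u
    simp only [id]
    change m (u + v) / g (u + v) / (m u / g u) * (g (u + v) / g u) = _
    field_simp
  · obtain ⟨C, hC, hCb⟩ := one_add_rpow_le_exp (abs_nonneg b) hr
    have key : ∀ z, z₀ ≤ z → ∀ y, z₀ ≤ y →
        m y ≤ 4 * C * m z * Real.exp (-(y - z) + r * |y - z|) := by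
      intro z hz y hy
      have h1 := rpow_le_rpow_mul_one_add (by linarith : 1 ≤ y) (by linarith : 1 ≤ z) b
      have h2 := hCb |y - z| (abs_nonneg _)
      have hzb : 0 < z ^ b := Real.rpow_pos_of_pos (by linarith) _
      calc m y ≤ 2 * g y := (hz₀ y hy).2
        _ ≤ 2 * (K * (z ^ b * (C * Real.exp (r * |y - z|))) * Real.exp (-y)) := by
            simp only [hg]
            gcongr
            exact h1.trans (by gcongr)
        _ = 2 * C * g z * Real.exp (-(y - z) + r * |y - z|) := by
            have : Real.exp (-(y - z) + r * |y - z|) =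
                Real.exp (-y) * Real.exp z * Real.exp (r * |y - z|) := by
              rw [← Real.exp_add, ← Real.exp_add]; congr 1; ring
            rw [this]
            have h3 : Real.exp (-z) * Real.exp z = 1 := by rw [← Real.exp_add]; simp
            simp only [hg]
            linear_combination -(2 * K * z ^ b * C * Real.exp (r * |y - z|) * Real.exp (-y)) * h3
        _ ≤ 2 * C * (2 * m z) * Real.exp (-(y - z) + r * |y - z|) := by
            gcongr
            exact (hz₀ z hz).1
        _ = _ := by ring
    have hm0 := hpos z₀
    refine ⟨4 * C * (1 + (m z₀)⁻¹), z₀, by positivity, fun u hu v => ?_⟩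
    have hmu := hpos u
    rcases le_total z₀ (u + v) with hv | hv
    · refine (key u hu (u + v) hv).trans ?_
      rw [add_sub_cancel_left]
      have h1 : 0 < (m z₀)⁻¹ := by positivity
      have h2 : 4 * C ≤ 4 * C * (1 + (m z₀)⁻¹) := by nlinarith
      gcongr
    -- Here u + v lies below z₀, where only m ≤ 1 is known. The bound is taken at z₀ and inflated by
    -- 1 / m z₀; since v ≤ z₀ - u ≤ 0, passing to v only enlarges the exponent.
    · have h1 := key u hu z₀ le_rfl
      calc m (u + v) ≤ 1 := hle _
        _ = (m z₀)⁻¹ * m z₀ := by field_simp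
        _ ≤ (m z₀)⁻¹ * (4 * C * m u * Real.exp (-(z₀ - u) + r * |z₀ - u|)) := by gcongr
        _ = 4 * C * (m z₀)⁻¹ * m u * Real.exp (-(z₀ - u) + r * |z₀ - u|) := by ring
        _ ≤ 4 * C * (1 + (m z₀)⁻¹) * m u * Real.exp (-v + r * |v|) := by
            rw [abs_of_nonpos (by linarith : z₀ - u ≤ 0), abs_of_nonpos (by linarith : v ≤ 0)]
            have h2 : (m z₀)⁻¹ ≤ 1 + (m z₀)⁻¹ := by linarith
            have h3 : -(z₀ - u) + r * -(z₀ - u) ≤ -v + r * -v := by nlinarith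
            gcongr

end ExponentialTail

/-! ### Riemann–Stieltjes bounds for the joint tail of (W, V + a W). -/

section PairTail

/-- The joint tail `P(W > y, V + a W > z)` for independent `W`, `V` with common law `ν`. -/
noncomputable def pairTail (ν : Measure ℝ) (a y z : ℝ) : ℝ :=
  (ν.prod ν).real {p : ℝ × ℝ | y < p.1 ∧ z < p.2 + a * p.1}

/-- The Riemann–Stieltjes sums (mesh `d`) for the joint tail `pairTail`. -/
noncomputable def pairSum (m : ℝ → ℝ) (a d c y z : ℝ) : ℝ :=
  ∑' k : ℕ, (m (y + k * d) - m (y + (k + 1) * d)) * m (z - a * (y + (k + c) * d))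

variable {ν : Measure ℝ} [IsProbabilityMeasure ν] {m : ℝ → ℝ}

lemma real_Ioc_eq_sub (hm : ∀ z, m z = ν.real (Ioi z)) {x y : ℝ} (hxy : x ≤ y) :
    ν.real (Ioc x y) = m x - m y := by
  rw [hm, hm, ← Ioi_sdiff_Ioi, measureReal_sdiff (Ioi_subset_Ioi hxy) measurableSet_Ioi]

/-- The event is cut into strips y + k d < W ≤ y + (k + 1) d. As a ≥ 0, the condition on V is
monotone in W, so each strip lies between two rectangles, with W replaced by its left or right
endpoint, and rectangles have product measure. The tags 0 and 1 match the argument `c` of `pairSum`.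
-/
lemma pairTail_cells (hm : ∀ z, m z = ν.real (Ioi z)) {a d : ℝ} (ha : 0 ≤ a) (hd : 0 < d)
    (y z : ℝ) : ∃ t : ℕ → ℝ, HasSum t (pairTail ν a y z) ∧ (∀ k : ℕ, 0 ≤ t k ∧
      (m (y + k * d) - m (y + (k + 1) * d)) * m (z - a * (y + (k + 0) * d)) ≤ t k ∧
      t k ≤ (m (y + k * d) - m (y + (k + 1) * d)) * m (z - a * (y + (k + 1) * d))) := by
  set A : ℕ → Set (ℝ × ℝ) := fun k =>
    {p | p.1 ∈ Ioc (y + k * d) (y + (k + 1) * d) ∧ z < p.2 + a * p.1} with hA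
  have hAm : ∀ k, MeasurableSet (A k) := fun k =>
    (measurable_fst measurableSet_Ioc).inter
      (measurableSet_lt measurable_const (measurable_snd.add (measurable_fst.const_mul a)))
  have hmono : Monotone fun k : ℕ => y + k * d := fun i j hij => by
    have : (i : ℝ) ≤ j := by exact_mod_cast hij
    simp only
    gcongr
  have hdisj : Pairwise (Function.onFun Disjoint A) := by
    intro i j hij
    have h1 := hmono.pairwise_disjoint_on_Ioc_succ hij
    simp only [Function.onFun, Order.succ_eq_add_one, Nat.cast_add,
      Nat.cast_one] at h1
    rw [Function.onFun, Set.disjoint_left]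
    intro p hp hp'
    exact Set.disjoint_left.1 h1 hp.1 hp'.1
  have hU : {p : ℝ × ℝ | y < p.1 ∧ z < p.2 + a * p.1} = ⋃ k, A k := by
    ext p
    simp only [mem_ofPred_eq, mem_iUnion, hA, mem_Ioc]
    constructor
    · rintro ⟨h1, h2⟩
      have h3 : 0 < (p.1 - y) / d := div_pos (by linarith) hd
      -- The ceiling, not the floor, because the strips are open on the left.
      obtain ⟨k, hk⟩ : ∃ k, ⌈(p.1 - y) / d⌉₊ = k + 1 :=
        Nat.exists_eq_succ_of_ne_zero (Nat.ceil_pos.2 h3).ne'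
      refine ⟨k, ⟨?_, ?_⟩, h2⟩
      · have : (k : ℝ) < (p.1 - y) / d := Nat.lt_ceil.1 (by omega)
        rw [lt_div_iff₀ hd] at this
        linarith
      · have : (p.1 - y) / d ≤ ((k + 1 : ℕ) : ℝ) := Nat.ceil_le.1 hk.le
        rw [div_le_iff₀ hd] at this
        push_cast at this
        linarith
    · rintro ⟨k, ⟨h1, _⟩, h2⟩
      exact ⟨lt_of_le_of_lt (by simp; positivity) h1, h2⟩
  refine ⟨fun k => (ν.prod ν).real (A k), ?_, fun k => ⟨measureReal_nonneg, ?_, ?_⟩⟩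
  · rw [pairTail, hU]
    have h1 := measure_iUnion (μ := ν.prod ν) hdisj hAm
    have h2 : (∑' k, (ν.prod ν) (A k)) ≠ ∞ := h1 ▸ measure_ne_top _ _
    simp only [Measure.real, h1]
    rw [ENNReal.tsum_toReal_eq fun k => measure_ne_top _ _]
    exact ENNReal.hasSum_toReal h2
  · have hsub : Ioc (y + k * d) (y + (k + 1) * d) ×ˢ Ioi (z - a * (y + (k + 0) * d)) ⊆ A k := by
      rintro ⟨w, v⟩ ⟨hw, hv⟩
      simp only [mem_Ioi, mem_Ioc] at hw hv
      refine ⟨hw, ?_⟩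
      have := mul_le_mul_of_nonneg_left hw.1.le ha
      simp only [add_zero] at hv
      change z < v + a * w
      linarith
    have := measureReal_mono (μ := ν.prod ν) hsub
    rwa [measureReal_prod_prod, real_Ioc_eq_sub hm (by linarith), ← hm] at this
  · have hsub : A k ⊆ Ioc (y + k * d) (y + (k + 1) * d) ×ˢ Ioi (z - a * (y + (k + 1) * d)) := by
      rintro ⟨w, v⟩ ⟨hw, hv⟩
      refine ⟨hw, ?_⟩
      have := mul_le_mul_of_nonneg_left hw.2 ha
      simp only [mem_Ioi]
      simp only at hv this
      linarith
    have := measureReal_mono (μ := ν.prod ν) hsub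
    rwa [measureReal_prod_prod, real_Ioc_eq_sub hm (by linarith), ← hm] at this

/-- The increments of m telescope to at most 1 and the other factor is at most 1. -/
lemma summable_cells (hm : ∀ z, m z = ν.real (Ioi z)) {d : ℝ} (hd : 0 < d) (y : ℝ) (s : ℕ → ℝ) :
    Summable fun k : ℕ => (m (y + k * d) - m (y + (k + 1) * d)) * m (s k) := by
  have hanti : Antitone m := fun x x' h => by
    rw [hm, hm]; exact measureReal_mono (Ioi_subset_Ioi h)
  have hn : ∀ k : ℕ, 0 ≤ m (y + k * d) - m (y + (k + 1) * d) := fun k =>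
    sub_nonneg.2 (hanti (by linarith))
  have h0 : ∀ z, 0 ≤ m z := fun z => hm z ▸ measureReal_nonneg
  have h1 : ∀ z, m z ≤ 1 := fun z => hm z ▸ measureReal_le_one
  refine Summable.of_nonneg_of_le (fun k => mul_nonneg (hn k) (h0 _))
    (fun k => mul_le_of_le_one_right (hn k) (h1 _)) ?_
  refine summable_of_sum_range_le (c := 1) hn fun n => ?_
  have := Finset.sum_range_sub' (fun k : ℕ => m (y + k * d)) n
  simp only [Nat.cast_add, Nat.cast_one] at this
  rw [this]
  have := h0 (y + n * d)
  have := h1 (y + (0 : ℕ) * d)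
  linarith

lemma pairSum_le_pairTail (hm : ∀ z, m z = ν.real (Ioi z)) {a d : ℝ} (ha : 0 ≤ a) (hd : 0 < d)
    (y z : ℝ) : pairSum m a d 0 y z ≤ pairTail ν a y z := by
  obtain ⟨t, ht, hb⟩ := pairTail_cells hm ha hd y z
  rw [← ht.tsum_eq]
  exact (summable_cells hm hd y _).tsum_le_tsum (fun k => (hb k).2.1) ht.summable

lemma pairTail_le_pairSum (hm : ∀ z, m z = ν.real (Ioi z)) {a d : ℝ} (ha : 0 ≤ a) (hd : 0 < d)
    (y z : ℝ) : pairTail ν a y z ≤ pairSum m a d 1 y z := by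
  obtain ⟨t, ht, hb⟩ := pairTail_cells hm ha hd y z
  rw [← ht.tsum_eq]
  exact ht.summable.tsum_le_tsum (fun k => (hb k).2.2) (summable_cells hm hd y _)

end PairTail

/-! ### Asymptotics of the joint tail for deterministic shifts. -/

section PairLimit

variable {m : ℝ → ℝ} {a : ℝ}

/-- A geometric majorant for the cells, uniform in u. Over k cells, Potter bounds at u and at (1 -
a) u cost e^{-(1 - r) k d} for W and e^{a (1 + r) k d} for V; the net rate 1 - r - a (1 + r) is
positive for small r because a < 1. -/
lemma pair_term_le (hm : IsExpTail m) (ha0 : 0 < a) (ha1 : a < 1) {r : ℝ} (hr : 0 < r) :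
    ∃ C u₀ : ℝ, 0 < C ∧ ∀ u, u₀ ≤ u → ∀ d c y z : ℝ, 0 ≤ d → 0 ≤ c → ∀ k : ℕ,
      (m (u + y + k * d) - m (u + y + (k + 1) * d)) * m (u + z - a * (u + y + (k + c) * d)) ≤
        C * (m u * m ((1 - a) * u)) * Real.exp (-(1 - a) * y - z + r * (2 * |y| + |z|)) *
          Real.exp (a * c * d * (1 + r)) * Real.exp (-(d * (1 - r - a * (1 + r)))) ^ k := by
  obtain ⟨C, u₀, hC, hP⟩ := hm.potter r hr
  have h1a : 0 < 1 - a := by linarith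
  -- The second entry of the maximum ensures (1 - a) u ≥ u₀.
  refine ⟨C * C, max u₀ (u₀ / (1 - a)), by positivity, fun u hu d c y z hd hc k => ?_⟩
  have hu1 : u₀ ≤ u := (le_max_left _ _).trans hu
  have hu2 : u₀ ≤ (1 - a) * u := by
    have := (le_max_right _ _).trans hu
    rw [div_le_iff₀ h1a] at this
    linarith
  have hp1 := hP u hu1 (y + k * d)
  have hp2 := hP ((1 - a) * u) hu2 (z - a * y - a * (k + c) * d)
  have e1 : u + (y + k * d) = u + y + k * d := by ring
  have e2 : (1 - a) * u + (z - a * y - a * (k + c) * d) = u + z - a * (u + y + (k + c) * d) := by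
    ring
  rw [e1] at hp1
  rw [e2] at hp2
  have hm1 := hm.pos (u + y + (k + 1) * d)
  have hm2 := hm.pos (u + z - a * (u + y + (k + c) * d))
  have hmu := hm.pos u
  have hmu' := hm.pos ((1 - a) * u)
  have hk : (0 : ℝ) ≤ k := Nat.cast_nonneg k
  calc _ ≤ m (u + y + k * d) * m (u + z - a * (u + y + (k + c) * d)) := by
        gcongr
        linarith
    _ ≤ (C * m u * Real.exp (-(y + k * d) + r * |y + k * d|)) *
        (C * m ((1 - a) * u) * Real.exp (-(z - a * y - a * (k + c) * d) +
          r * |z - a * y - a * (k + c) * d|)) := by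
        gcongr
    _ = C * C * (m u * m ((1 - a) * u)) * Real.exp (-(y + k * d) + r * |y + k * d| +
        (-(z - a * y - a * (k + c) * d) + r * |z - a * y - a * (k + c) * d|)) := by
        rw [Real.exp_add (-(y + k * d) + r * |y + k * d|)]; ring
    _ ≤ C * C * (m u * m ((1 - a) * u)) * Real.exp ((-(1 - a) * y - z + r * (2 * |y| + |z|)) +
        a * c * d * (1 + r) + k * (-(d * (1 - r - a * (1 + r))))) := by
        refine mul_le_mul_of_nonneg_left (Real.exp_le_exp.2 ?_) (by positivity)
        have h1 : |y + k * d| ≤ |y| + k * d :=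
          (abs_add_le _ _).trans_eq (by rw [abs_of_nonneg (mul_nonneg hk hd)])
        have h2 : |z - a * y - a * (k + c) * d| ≤ |z| + |y| + a * (k + c) * d := by
          have h3 : |a * y| ≤ |y| := by
            rw [abs_mul, abs_of_pos ha0]
            exact mul_le_of_le_one_left (abs_nonneg _) ha1.le
          have h4 : |a * (k + c) * d| = a * (k + c) * d := abs_of_nonneg (by positivity)
          have h5 := abs_sub (z - a * y) (a * (k + c) * d)
          have h6 := abs_sub z (a * y)
          linarith
        have h1' := mul_le_mul_of_nonneg_left h1 hr.le
        have h2' := mul_le_mul_of_nonneg_left h2 hr.le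
        nlinarith
    _ = _ := by
        rw [Real.exp_add, Real.exp_add, ← Real.exp_nat_mul]; ring

lemma exists_potter_exponent (ha1 : a < 1) :
    ∃ r : ℝ, 0 < r ∧ 0 < 1 - r - a * (1 + r) := by
  refine ⟨(1 - a) / 4, by linarith, ?_⟩
  nlinarith

/-- For a fixed mesh each cell converges to its exponential counterpart, dominated convergence for
series applies by `pair_term_le`, and the limits form a geometric series of ratio e^{-(1 - a) d}. -/
lemma tendsto_pairSum (hm : IsExpTail m) (ha0 : 0 < a) (ha1 : a < 1) {d c : ℝ} (hd : 0 < d)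
    (hc : 0 ≤ c) (y z : ℝ) :
    Tendsto (fun u => pairSum m a d c (u + y) (u + z) / (m u * m ((1 - a) * u))) atTop
      (𝓝 (Real.exp (-(1 - a) * y - z) * ((1 - Real.exp (-d)) * Real.exp (a * c * d) /
        (1 - Real.exp (-((1 - a) * d)))))) := by
  obtain ⟨r, hr, hr1⟩ := exists_potter_exponent ha1
  obtain ⟨C, u₀, hC, hB⟩ := pair_term_le hm ha0 ha1 hr
  have h1a : 0 < 1 - a := by linarith
  set q := Real.exp (-(d * (1 - r - a * (1 + r)))) with hq
  have hq1 : q < 1 := by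
    rw [hq, Real.exp_lt_one_iff]
    have := mul_pos hd hr1
    linarith
  have hq' : Real.exp (-((1 - a) * d)) < 1 := by
    rw [Real.exp_lt_one_iff]
    have := mul_pos h1a hd
    linarith
  have hsum : Real.exp (-(1 - a) * y - z) * ((1 - Real.exp (-d)) * Real.exp (a * c * d) /
      (1 - Real.exp (-((1 - a) * d)))) = ∑' k : ℕ,
      (Real.exp (-(y + k * d)) - Real.exp (-(y + (k + 1) * d))) *
        Real.exp (-(z - a * y - a * (k + c) * d)) := by
    have : ∀ k : ℕ, (Real.exp (-(y + k * d)) - Real.exp (-(y + (k + 1) * d))) *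
        Real.exp (-(z - a * y - a * (k + c) * d)) = Real.exp (-(1 - a) * y - z) *
        ((1 - Real.exp (-d)) * Real.exp (a * c * d)) * Real.exp (-((1 - a) * d)) ^ k := by
      intro k
      rw [← Real.exp_nat_mul, sub_mul, ← Real.exp_add, ← Real.exp_add, sub_mul, mul_sub, sub_mul,
        one_mul, ← Real.exp_add, ← Real.exp_add, ← Real.exp_add, ← Real.exp_add, ← Real.exp_add]
      congr 2 <;> ring
    rw [tsum_congr this, tsum_mul_left, tsum_geometric_of_lt_one (Real.exp_pos _).le hq']
    ring
  rw [hsum]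
  have hlim1 := hm.ratio
  have hat : Tendsto (fun u : ℝ => (1 - a) * u) atTop atTop := tendsto_id.const_mul_atTop h1a
  have hD : ∀ u, 0 < m u * m ((1 - a) * u) := fun u => mul_pos (hm.pos _) (hm.pos _)
  have := tendsto_tsum_of_dominated_convergence (𝓕 := atTop)
    (f := fun (u : ℝ) (k : ℕ) => (m (u + y + k * d) - m (u + y + (k + 1) * d)) *
      m (u + z - a * (u + y + (k + c) * d)) / (m u * m ((1 - a) * u)))
    (g := fun k : ℕ => (Real.exp (-(y + k * d)) - Real.exp (-(y + (k + 1) * d))) *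
        Real.exp (-(z - a * y - a * (k + c) * d)))
    (bound := fun k => C * Real.exp (-(1 - a) * y - z + r * (2 * |y| + |z|)) *
          Real.exp (a * c * d * (1 + r)) * q ^ k)
    ((summable_geometric_of_lt_one (Real.exp_pos _).le hq1).mul_left _) ?_ ?_
  · refine this.congr fun u => ?_
    rw [pairSum, tsum_div_const]
  · intro k
    have l1 := hlim1 (y + k * d)
    have l2 := hlim1 (y + (k + 1) * d)
    have l3 := (hlim1 (z - a * y - a * (k + c) * d)).comp hat
    refine ((l1.sub l2).mul l3).congr fun u => ?_
    have e2 : (1 - a) * u + (z - a * y - a * (k + c) * d) =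
      u + z - a * (u + y + (k + c) * d) := by ring
    simp only [Function.comp, e2, ← add_assoc, ← sub_div, div_mul_div_comm]
  · filter_upwards [eventually_ge_atTop u₀] with u hu k
    have h1 := hB u hu d c y z hd.le hc k
    have h2 : 0 ≤ m (u + y + k * d) - m (u + y + (k + 1) * d) :=
      sub_nonneg.2 (hm.antitone (by linarith))
    rw [Real.norm_of_nonneg (div_nonneg (mul_nonneg h2 (hm.pos _).le) (hD u).le),
      div_le_iff₀ (hD u)]
    refine h1.trans_eq ?_
    ring

variable {ν : Measure ℝ} [IsProbabilityMeasure ν]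

lemma pairTail_le (hm : IsExpTail m) (hmν : ∀ z, m z = ν.real (Ioi z)) (ha0 : 0 < a) (ha1 : a < 1)
    {r : ℝ} (hr : 0 < r) (hr1 : 0 < 1 - r - a * (1 + r)) :
    ∃ C u₀ : ℝ, 0 < C ∧ ∀ u, u₀ ≤ u → ∀ y z : ℝ, pairTail ν a (u + y) (u + z) ≤
      C * (m u * m ((1 - a) * u)) * Real.exp (-(1 - a) * y - z + r * (2 * |y| + |z|)) := by
  obtain ⟨C, u₀, hC, hB⟩ := pair_term_le hm ha0 ha1 hr
  set q := Real.exp (-(1 * (1 - r - a * (1 + r)))) with hq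
  have hq1 : q < 1 := by
    rw [hq, Real.exp_lt_one_iff]
    linarith
  have hq2 : 0 < 1 - q := by linarith
  refine ⟨C * Real.exp (a * 1 * 1 * (1 + r)) * (1 - q)⁻¹, u₀, by positivity, fun u hu y z => ?_⟩
  -- For a mere bound, the upper sum of mesh 1 suffices.
  refine (pairTail_le_pairSum hmν ha0.le one_pos _ _).trans ?_
  have h1 : HasSum (fun k : ℕ => C * (m u * m ((1 - a) * u)) *
      Real.exp (-(1 - a) * y - z + r * (2 * |y| + |z|)) * Real.exp (a * 1 * 1 * (1 + r)) * q ^ k) _ :=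
    (hasSum_geometric_of_lt_one (Real.exp_pos _).le hq1).mul_left _
  refine ((summable_cells hmν one_pos _ _).tsum_le_tsum
    (fun k => hB u hu 1 1 y z zero_le_one zero_le_one k) h1.summable).trans_eq ?_
  rw [h1.tsum_eq]
  ring

lemma tendsto_one_sub_exp_div (b : ℝ) :
    Tendsto (fun d : ℝ => (1 - Real.exp (-(b * d))) / d) (𝓝[>] 0) (𝓝 b) := by
  have h1 : HasDerivAt (fun d : ℝ => 1 - Real.exp (-(b * d))) b 0 := by
    have := (((hasDerivAt_id (0 : ℝ)).const_mul b).neg.exp).const_sub 1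
    simpa using this
  have h2 := h1.tendsto_slope_zero_right
  refine h2.congr fun d => ?_
  simp [div_eq_inv_mul]

/-- Asymptotics of the joint tail of `(W, V + a W)`. -/
theorem tendsto_pairTail (hm : IsExpTail m) (hmν : ∀ z, m z = ν.real (Ioi z)) (ha0 : 0 < a)
    (ha1 : a < 1) (y z : ℝ) :
    Tendsto (fun u => pairTail ν a (u + y) (u + z) / (m u * m ((1 - a) * u))) atTop
      (𝓝 (Real.exp (-(1 - a) * y - z) / (1 - a))) := by
  have h1a : 0 < 1 - a := by linarith
  have hD : ∀ u, 0 < m u * m ((1 - a) * u) := fun u => mul_pos (hm.pos _) (hm.pos _)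
  -- As d → 0 the limits of the lower (c = 0) and upper (c = 1) sums coincide. A small d is fixed
  -- below before u → ∞.
  have hlim : ∀ c : ℝ, Tendsto (fun d => Real.exp (-(1 - a) * y - z) *
      ((1 - Real.exp (-d)) * Real.exp (a * c * d) / (1 - Real.exp (-((1 - a) * d))))) (𝓝[>] 0)
      (𝓝 (Real.exp (-(1 - a) * y - z) / (1 - a))) := by
    intro c
    have h1 : Tendsto (fun d : ℝ => Real.exp (a * c * d)) (𝓝[>] 0) (𝓝 1) := by
      have : Continuous fun d : ℝ => Real.exp (a * c * d) := by fun_prop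
      simpa using (this.tendsto 0).mono_left nhdsWithin_le_nhds
    have h2 := ((((tendsto_one_sub_exp_div 1).mul h1).div
      (tendsto_one_sub_exp_div (1 - a)) h1a.ne').const_mul (Real.exp (-(1 - a) * y - z)))
    rw [one_mul, mul_one_div] at h2
    refine h2.congr' ?_
    filter_upwards [self_mem_nhdsWithin] with d hd
    have hd' : d ≠ 0 := ne_of_gt hd
    simp only [Pi.div_apply, one_mul]
    rw [div_mul_eq_mul_div, div_div_div_cancel_right₀ hd']
  refine tendsto_order.2 ⟨fun l hl => ?_, fun l hl => ?_⟩
  · obtain ⟨d, hd1, hd⟩ := (((hlim 0).eventually (lt_mem_nhds hl)).and self_mem_nhdsWithin).exists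
    filter_upwards [(tendsto_pairSum hm ha0 ha1 hd le_rfl y z).eventually (lt_mem_nhds hd1)]
      with u hu
    exact hu.trans_le (div_le_div_of_nonneg_right (pairSum_le_pairTail hmν ha0.le hd _ _) (hD u).le)
  · obtain ⟨d, hd1, hd⟩ := (((hlim 1).eventually (gt_mem_nhds hl)).and self_mem_nhdsWithin).exists
    filter_upwards [(tendsto_pairSum hm ha0 ha1 hd zero_le_one y z).eventually (gt_mem_nhds hd1)]
      with u hu
    exact (div_le_div_of_nonneg_right (pairTail_le_pairSum hmν ha0.le hd _ _) (hD u).le).trans_lt hu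

end PairLimit

/-! ### Random shifts, by dominated convergence. -/

section RandomShift

variable {m : ℝ → ℝ} {a : ℝ} {ν : Measure ℝ} [IsProbabilityMeasure ν]
  {Ω : Type*} [MeasurableSpace Ω] {μ : Measure Ω}

lemma measurable_pairTail (ν : Measure ℝ) [IsProbabilityMeasure ν] (a : ℝ) :
    Measurable fun q : ℝ × ℝ => pairTail ν a q.1 q.2 := by
  have hs : MeasurableSet {q : (ℝ × ℝ) × (ℝ × ℝ) | q.1.1 < q.2.1 ∧ q.1.2 < q.2.2 + a * q.2.1} :=
    (measurableSet_lt (measurable_fst.comp measurable_fst) (measurable_fst.comp measurable_snd)).inter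
      (measurableSet_lt (measurable_snd.comp measurable_fst) ((measurable_snd.comp
        measurable_snd).add ((measurable_fst.comp measurable_snd).const_mul a)))
  exact (measurable_measure_prodMk_left (ν := ν.prod ν) hs).ennreal_toReal

/-- The bound `pairTail_le` is uniform in the shifts, so with random shifts it yields the integrable
majorant `hint`. The measure is arbitrary, which allows its restriction to the event where the
return innovations are positive. -/
theorem tendsto_integral_pairTail (hm : IsExpTail m) (hmν : ∀ z, m z = ν.real (Ioi z))
    (ha0 : 0 < a) (ha1 : a < 1) {r : ℝ} (hr : 0 < r) (hr1 : 0 < 1 - r - a * (1 + r))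
    {T₀ T₁ : Ω → ℝ} (h₀ : Measurable T₀) (h₁ : Measurable T₁)
    (hint : Integrable
      (fun ω => Real.exp ((1 - a) * T₀ ω + T₁ ω + r * (2 * |T₀ ω| + |T₁ ω|))) μ) (y z : ℝ) :
    Tendsto (fun u => (∫ ω, pairTail ν a (u + y - T₀ ω) (u + z - T₁ ω) ∂μ) /
        (m u * m ((1 - a) * u))) atTop
      (𝓝 (Real.exp (-(1 - a) * y - z) *
        ((∫ ω, Real.exp ((1 - a) * T₀ ω + T₁ ω) ∂μ) / (1 - a)))) := by
  obtain ⟨C, u₀, hC, hB⟩ := pairTail_le hm hmν ha0 ha1 hr hr1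
  have hD : ∀ u, 0 < m u * m ((1 - a) * u) := fun u => mul_pos (hm.pos _) (hm.pos _)
  have e : Real.exp (-(1 - a) * y - z) *
        ((∫ ω, Real.exp ((1 - a) * T₀ ω + T₁ ω) ∂μ) / (1 - a)) =
      ∫ ω, Real.exp (-(1 - a) * (y - T₀ ω) - (z - T₁ ω)) / (1 - a) ∂μ := by
    rw [integral_div, ← mul_div_assoc, ← integral_const_mul]
    congr 2
    funext ω
    rw [← Real.exp_add]
    congr 1; ring
  rw [e]
  simp_rw [← integral_div]
  refine tendsto_integral_filter_of_dominated_convergence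
    (fun ω => C * Real.exp (-(1 - a) * y - z + r * (2 * |y| + |z|)) *
      Real.exp ((1 - a) * T₀ ω + T₁ ω + r * (2 * |T₀ ω| + |T₁ ω|))) ?_ ?_ (hint.const_mul _) ?_
  · refine Eventually.of_forall fun u => Measurable.aestronglyMeasurable ?_
    exact ((measurable_pairTail ν a).comp
      ((measurable_const.sub h₀).prodMk (measurable_const.sub h₁))).div_const _
  · filter_upwards [eventually_ge_atTop u₀] with u hu
    refine Eventually.of_forall fun ω => ?_
    have h1 := hB u hu (y - T₀ ω) (z - T₁ ω)
    have h0 : 0 ≤ pairTail ν a (u + y - T₀ ω) (u + z - T₁ ω) := measureReal_nonneg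
    rw [Real.norm_of_nonneg (div_nonneg h0 (hD u).le), div_le_iff₀ (hD u),
      add_sub_assoc, add_sub_assoc]
    refine h1.trans ?_
    have h2 : -(1 - a) * (y - T₀ ω) - (z - T₁ ω) + r * (2 * |y - T₀ ω| + |z - T₁ ω|) ≤
        (-(1 - a) * y - z + r * (2 * |y| + |z|)) +
          ((1 - a) * T₀ ω + T₁ ω + r * (2 * |T₀ ω| + |T₁ ω|)) := by
      have h3 := mul_le_mul_of_nonneg_left (abs_sub y (T₀ ω)) hr.le
      have h4 := mul_le_mul_of_nonneg_left (abs_sub z (T₁ ω)) hr.le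
      linarith
    calc _ ≤ C * (m u * m ((1 - a) * u)) * Real.exp ((-(1 - a) * y - z + r * (2 * |y| + |z|)) +
          ((1 - a) * T₀ ω + T₁ ω + r * (2 * |T₀ ω| + |T₁ ω|))) :=
        mul_le_mul_of_nonneg_left (Real.exp_le_exp.2 h2) (mul_pos hC (hD u)).le
      _ = _ := by rw [Real.exp_add]; ring
  · refine Eventually.of_forall fun ω => ?_
    simp only [add_sub_assoc]
    exact tendsto_pairTail hm hmν ha0 ha1 _ _

theorem tendsto_integral_tail (hm : IsExpTail m) {r : ℝ} (hr : 0 < r)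
    {T : Ω → ℝ} (hT : Measurable T)
    (hint : Integrable (fun ω => Real.exp (T ω + r * |T ω|)) μ) (y : ℝ) :
    Tendsto (fun u => (∫ ω, m (u + y - T ω) ∂μ) / m u) atTop
      (𝓝 (Real.exp (-y) * ∫ ω, Real.exp (T ω) ∂μ)) := by
  obtain ⟨C, u₀, hC, hB⟩ := hm.potter r hr
  have e : Real.exp (-y) * ∫ ω, Real.exp (T ω) ∂μ = ∫ ω, Real.exp (-(y - T ω)) ∂μ := by
    rw [← integral_const_mul]
    congr 1
    funext ω
    rw [← Real.exp_add]
    congr 1; ring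
  rw [e]
  simp_rw [← integral_div]
  refine tendsto_integral_filter_of_dominated_convergence
    (fun ω => C * Real.exp (-y + r * |y|) * Real.exp (T ω + r * |T ω|)) ?_ ?_
    (hint.const_mul _) ?_
  · refine Eventually.of_forall fun u => Measurable.aestronglyMeasurable ?_
    exact (hm.antitone.measurable.comp (measurable_const.sub hT)).div_const _
  · filter_upwards [eventually_ge_atTop u₀] with u hu
    refine Eventually.of_forall fun ω => ?_
    have h1 := hB u hu (y - T ω)
    have hmu := hm.pos u
    rw [Real.norm_of_nonneg (div_nonneg (hm.pos _).le hmu.le), div_le_iff₀ hmu, add_sub_assoc]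
    refine h1.trans ?_
    have h2 : -(y - T ω) + r * |y - T ω| ≤ (-y + r * |y|) + (T ω + r * |T ω|) := by
      have h3 := mul_le_mul_of_nonneg_left (abs_sub y (T ω)) hr.le
      linarith
    calc _ ≤ C * m u * Real.exp ((-y + r * |y|) + (T ω + r * |T ω|)) :=
        mul_le_mul_of_nonneg_left (Real.exp_le_exp.2 h2) (mul_pos hC hmu).le
      _ = _ := by rw [Real.exp_add]; ring
  · refine Eventually.of_forall fun ω => ?_
    simp only [add_sub_assoc]
    exact hm.ratio _

end RandomShift

/-! ### Exponential moments of η and of series in i.i.d. copies. -/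

section ExponentialMoments

variable {m : ℝ → ℝ} {ν : Measure ℝ} [IsProbabilityMeasure ν]
  {Ω : Type*} [MeasurableSpace Ω] {μ : Measure Ω}

/-- Cut the line into unit layers above w. With Potter exponent (1 - c) / 2, layer k contributes at
most a multiple of e^{-(1 - c) k / 2}. -/
lemma lintegral_exp_lt_top (hm : IsExpTail m) (hmν : ∀ z, m z = ν.real (Ioi z)) {c : ℝ}
    (hc0 : 0 < c) (hc1 : c < 1) : ∫⁻ x, ENNReal.ofReal (Real.exp (c * x)) ∂ν < ∞ := by
  obtain ⟨C, w, hC, hP⟩ := hm.potter ((1 - c) / 2) (by linarith)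
  have hpt : ∀ x : ℝ, ENNReal.ofReal (Real.exp (c * x)) ≤ ENNReal.ofReal (Real.exp (c * w)) +
      ∑' k : ℕ, (Ioi (w + k)).indicator
        (fun _ => ENNReal.ofReal (Real.exp (c * (w + k + 1)))) x := by
    intro x
    rcases le_or_gt x w with hx | hx
    · refine le_trans ?_ le_self_add
      gcongr
    · refine le_trans ?_ le_add_self
      obtain ⟨k, hk⟩ : ∃ k, ⌈x - w⌉₊ = k + 1 :=
        Nat.exists_eq_succ_of_ne_zero (Nat.ceil_pos.2 (by linarith)).ne'
      refine le_trans ?_ (ENNReal.le_tsum k)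
      have h1 : (k : ℝ) < x - w := Nat.lt_ceil.1 (by omega)
      have h2 : x - w ≤ ((k + 1 : ℕ) : ℝ) := Nat.ceil_le.1 hk.le
      push_cast at h2
      rw [indicator_of_mem (by simp only [mem_Ioi]; linarith)]
      gcongr
      linarith
  refine (lintegral_mono hpt).trans_lt ?_
  rw [lintegral_add_left measurable_const, lintegral_const, measure_univ, mul_one,
    lintegral_tsum fun k => (measurable_const.indicator measurableSet_Ioi).aemeasurable]
  refine ENNReal.add_lt_top.2 ⟨ENNReal.ofReal_lt_top, ?_⟩
  set q := Real.exp (-((1 - c) / 2)) with hq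
  have hq1 : q < 1 := by
    rw [hq, Real.exp_lt_one_iff]; linarith
  have hle : ∀ k : ℕ, ∫⁻ x, (Ioi (w + k)).indicator
      (fun _ => ENNReal.ofReal (Real.exp (c * (w + k + 1)))) x ∂ν ≤
      ENNReal.ofReal (C * m w * Real.exp (c * (w + 1)) * q ^ k) := by
    intro k
    rw [lintegral_indicator_const measurableSet_Ioi, ← ofReal_measureReal,
      ← ENNReal.ofReal_mul (Real.exp_pos _).le, ← hmν]
    refine ENNReal.ofReal_le_ofReal ?_
    have h1 := hP w le_rfl k
    rw [abs_of_nonneg (Nat.cast_nonneg k)] at h1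
    calc _ ≤ Real.exp (c * (w + k + 1)) *
          (C * m w * Real.exp (-(k : ℝ) + (1 - c) / 2 * k)) := by gcongr
      _ = C * m w * (Real.exp (c * (w + k + 1)) * Real.exp (-(k : ℝ) + (1 - c) / 2 * k)) := by
          ring
      _ = C * m w * (Real.exp (c * (w + 1)) * Real.exp (k * -((1 - c) / 2))) := by
          rw [← Real.exp_add, ← Real.exp_add]
          congr 2; ring
      _ = _ := by rw [hq, ← Real.exp_nat_mul]; ring
  refine (ENNReal.tsum_le_tsum hle).trans_lt ?_
  have hmw := hm.pos w
  have hs : Summable fun k : ℕ => C * m w * Real.exp (c * (w + 1)) * q ^ k :=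
    (summable_geometric_of_lt_one (Real.exp_pos _).le hq1).mul_left _
  rw [← ENNReal.ofReal_tsum_of_nonneg (fun k => by positivity) hs]
  exact ENNReal.ofReal_lt_top

/-- By convexity of exp between 0 and c₀ x, followed by 1 + t ≤ e^t. The exponent of the bound is
linear in c, so products over summable coefficients stay bounded. -/
lemma lintegral_exp_le {c₀ c : ℝ} (hc₀ : 0 < c₀) (hc : c ∈ Icc 0 c₀)
    (hM : ∫⁻ x, ENNReal.ofReal (Real.exp (c₀ * x)) ∂ν ≠ ∞) :
    ∫⁻ x, ENNReal.ofReal (Real.exp (c * x)) ∂ν ≤ ENNReal.ofReal (Real.exp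
      (c / c₀ * (∫⁻ x, ENNReal.ofReal (Real.exp (c₀ * x)) ∂ν).toReal)) := by
  set M := ∫⁻ x, ENNReal.ofReal (Real.exp (c₀ * x)) ∂ν
  have hl0 : 0 ≤ c / c₀ := div_nonneg hc.1 hc₀.le
  have hl1 : c / c₀ ≤ 1 := (div_le_one hc₀).2 hc.2
  have hpt : ∀ x : ℝ, ENNReal.ofReal (Real.exp (c * x)) ≤
      1 + ENNReal.ofReal (c / c₀) * ENNReal.ofReal (Real.exp (c₀ * x)) := by
    intro x
    rw [← ENNReal.ofReal_one, ← ENNReal.ofReal_mul hl0,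
      ← ENNReal.ofReal_add zero_le_one (by positivity)]
    refine ENNReal.ofReal_le_ofReal ?_
    have := convexOn_exp.2 (mem_univ 0) (mem_univ (c₀ * x)) (sub_nonneg.2 hl1) hl0 (by ring)
    have e : c / c₀ * (c₀ * x) = c * x := by field_simp
    simp only [smul_eq_mul, mul_zero, zero_add, Real.exp_zero, mul_one, e] at this
    linarith
  refine (lintegral_mono hpt).trans ?_
  rw [lintegral_add_left measurable_const, lintegral_const_mul _ (by fun_prop), lintegral_const,
    measure_univ, mul_one]
  change 1 + ENNReal.ofReal (c / c₀) * M ≤ _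
  rw [← ENNReal.ofReal_toReal hM, ← ENNReal.ofReal_one, ← ENNReal.ofReal_mul hl0,
    ← ENNReal.ofReal_add zero_le_one (by positivity), ENNReal.ofReal_toReal hM]
  refine ENNReal.ofReal_le_ofReal ?_
  linarith [Real.add_one_le_exp (c / c₀ * M.toReal)]

/-- Exponential moments of a random series of independent identically distributed variables. -/
theorem lintegral_exp_series_lt_top {ξ : ℕ → Ω → ℝ} (hξ : ∀ j, Measurable (ξ j))
    (hind : iIndepFun ξ μ) (hlaw : ∀ j, μ.map (ξ j) = ν) {c₀ : ℝ} (hc₀ : 0 < c₀)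
    (hM : ∫⁻ x, ENNReal.ofReal (Real.exp (c₀ * x)) ∂ν ≠ ∞) {c : ℕ → ℝ}
    (hc : ∀ j, c j ∈ Icc 0 c₀) (hcs : Summable c) {Y : Ω → ℝ}
    (hY : ∀ᵐ ω ∂μ, Tendsto (fun n => ∑ j ∈ Finset.range n, c j * ξ j ω) atTop (𝓝 (Y ω))) :
    ∫⁻ ω, ENNReal.ofReal (Real.exp (Y ω)) ∂μ < ∞ := by
  set M := (∫⁻ x, ENNReal.ofReal (Real.exp (c₀ * x)) ∂ν).toReal with hMdef
  have hM0 : 0 ≤ M := ENNReal.toReal_nonneg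
  have hpart : ∀ n, ∫⁻ ω, ENNReal.ofReal (Real.exp (∑ j ∈ Finset.range n, c j * ξ j ω)) ∂μ ≤
      ENNReal.ofReal (Real.exp ((∑' j, c j) * (M / c₀))) := by
    intro n
    have hi : iIndepFun (fun j ω => ENNReal.ofReal (Real.exp (c j * ξ j ω))) μ :=
      hind.comp (fun j x => ENNReal.ofReal (Real.exp (c j * x))) fun j => by fun_prop
    calc _ = ∫⁻ ω, ∏ j ∈ Finset.range n, ENNReal.ofReal (Real.exp (c j * ξ j ω)) ∂μ := by
          refine lintegral_congr fun ω => ?_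
          rw [Real.exp_sum, ENNReal.ofReal_prod_of_nonneg fun _ _ => (Real.exp_pos _).le]
      _ = ∏ j ∈ Finset.range n, ∫⁻ ω, ENNReal.ofReal (Real.exp (c j * ξ j ω)) ∂μ :=
          lintegral_prod_eq_prod_lintegral_of_indepFun _ _ hi fun j => by
            have := hξ j; fun_prop
      _ ≤ ∏ j ∈ Finset.range n, ENNReal.ofReal (Real.exp (c j / c₀ * M)) := by
          refine Finset.prod_le_prod' fun j _ => ?_
          have := lintegral_exp_le hc₀ (hc j) hM
          rwa [← hlaw j, lintegral_map (by fun_prop) (hξ j), hlaw j] at this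
      _ = ENNReal.ofReal (Real.exp ((∑ j ∈ Finset.range n, c j) * (M / c₀))) := by
          rw [← ENNReal.ofReal_prod_of_nonneg fun _ _ => (Real.exp_pos _).le, ← Real.exp_sum,
            Finset.sum_mul]
          congr 3
          funext j; ring
      _ ≤ _ := by
          gcongr
          exact hcs.sum_le_tsum _ fun j _ => (hc j).1
  -- Fatou's lemma transfers the uniform bound from partial sums to the series.
  have hfat := lintegral_liminf_le (μ := μ) (u := atTop) (f := fun (n : ℕ) ω =>
    ENNReal.ofReal (Real.exp (∑ j ∈ Finset.range n, c j * ξ j ω))) fun n => by fun_prop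
  have heq : ∫⁻ ω, ENNReal.ofReal (Real.exp (Y ω)) ∂μ = ∫⁻ ω, liminf (fun n =>
      ENNReal.ofReal (Real.exp (∑ j ∈ Finset.range n, c j * ξ j ω))) atTop ∂μ := by
    refine lintegral_congr_ae ?_
    filter_upwards [hY] with ω hω
    exact ((ENNReal.continuous_ofReal.tendsto _).comp
      ((Real.continuous_exp.tendsto _).comp hω)).liminf_eq.symm
  rw [heq]
  refine hfat.trans_lt (lt_of_le_of_lt ?_
    (ENNReal.ofReal_lt_top (r := Real.exp ((∑' j, c j) * (M / c₀)))))
  exact liminf_le_of_frequently_le' (Frequently.of_forall hpart)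

end ExponentialMoments

/-! ### Independence of blocks and conditioning by Fubini. -/

section Independence

variable {Ω : Type*} [MeasurableSpace Ω] {μ : Measure Ω}

/-- The σ-algebra of a subfamily, possibly infinite, is the supremum of those of its members, so
disjoint suprema of independent σ-algebras apply. -/
lemma indepFun_of_disjoint_index {ι : Type*} {f : ι → Ω → ℝ} (hf : iIndepFun f μ)
    (hm : ∀ i, Measurable (f i)) {S T : Set ι} (hST : Disjoint S T) :
    IndepFun (fun ω (i : S) => f i ω) (fun ω (i : T) => f i ω) μ := by
  have h1 := indep_iSup_of_disjoint (fun i => (hm i).comap_le) hf.iIndep hST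
  have key : ∀ R : Set ι, MeasurableSpace.comap (fun ω (i : R) => f i ω) inferInstance =
      ⨆ i ∈ R, MeasurableSpace.comap (f i) inferInstance := by
    intro R
    rw [iSup_subtype']
    simp only [MeasurableSpace.pi, MeasurableSpace.comap_iSup, MeasurableSpace.comap_comp]
    rfl
  rw [IndepFun_iff_Indep, key, key]
  exact h1

/-- The hypotheses make the law of (U, R, E) a product of three laws, which can be bracketed either
way. -/
lemma indepFun_prodMk_of_indepFun_prodMk [IsProbabilityMeasure μ] {A B C : Type*}
    [MeasurableSpace A] [MeasurableSpace B] [MeasurableSpace C] {U : Ω → A} {R : Ω → B} {E : Ω → C} (hU : Measurable U)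
    (hR : Measurable R) (hE : Measurable E) (h1 : IndepFun U R μ)
    (h2 : IndepFun (fun ω => (U ω, R ω)) E μ) : IndepFun U (fun ω => (R ω, E ω)) μ := by
  have hRE : IndepFun R E μ := h2.comp measurable_snd measurable_id
  rw [indepFun_iff_map_prod_eq_prod_map_map hU.aemeasurable (hR.prodMk hE).aemeasurable,
    hRE.map_prod_eq_prod_map_map hR.aemeasurable hE.aemeasurable]
  have h3 := h2.map_prod_eq_prod_map_map (hU.prodMk hR).aemeasurable hE.aemeasurable
  rw [h1.map_prod_eq_prod_map_map hU.aemeasurable hR.aemeasurable] at h3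
  have := Measure.isProbabilityMeasure_map (μ := μ) hU.aemeasurable
  have := Measure.isProbabilityMeasure_map (μ := μ) hR.aemeasurable
  have := Measure.isProbabilityMeasure_map (μ := μ) hE.aemeasurable
  rw [← Measure.prodAssoc_prod, ← h3,
    Measure.map_map MeasurableEquiv.prodAssoc.measurable ((hU.prodMk hR).prodMk hE)]
  rfl

lemma measure_pair_mem_of_indepFun [IsProbabilityMeasure μ] {A B : Type*}
    [MeasurableSpace A] [MeasurableSpace B]
    {U : Ω → A} {Z : Ω → B} (hU : Measurable U) (hZ : Measurable Z) (hind : IndepFun U Z μ)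
    {S : Set (B × A)} (hS : MeasurableSet S) :
    μ {ω | (Z ω, U ω) ∈ S} = ∫⁻ ω, (μ.map U) {u | (Z ω, u) ∈ S} ∂μ := by
  have := Measure.isProbabilityMeasure_map (μ := μ) hU.aemeasurable
  have := Measure.isProbabilityMeasure_map (μ := μ) hZ.aemeasurable
  have h1 := hind.symm.map_prod_eq_prod_map_map hZ.aemeasurable hU.aemeasurable
  have h2 : μ {ω | (Z ω, U ω) ∈ S} = (μ.map fun ω => (Z ω, U ω)) S :=
    (Measure.map_apply (hZ.prodMk hU) hS).symm
  rw [h2, h1, Measure.prod_apply hS, lintegral_map (measurable_measure_prodMk_left hS) hZ]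
  rfl

lemma measureReal_pair_mem_of_indepFun [IsProbabilityMeasure μ] {A B : Type*} [MeasurableSpace A]
    [MeasurableSpace B] {U : Ω → A} {Z : Ω → B} (hU : Measurable U) (hZ : Measurable Z)
    (hind : IndepFun U Z μ) {S : Set (B × A)} (hS : MeasurableSet S) :
    μ.real {ω | (Z ω, U ω) ∈ S} = ∫ ω, (μ.map U).real {u | (Z ω, u) ∈ S} ∂μ := by
  have := Measure.isProbabilityMeasure_map (μ := μ) hU.aemeasurable
  have h1 : Measurable fun ω => (μ.map U) {u | (Z ω, u) ∈ S} :=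
    (measurable_measure_prodMk_left hS).comp hZ
  have h2 := integral_toReal (μ := μ) h1.aemeasurable
    (Eventually.of_forall fun ω => measure_lt_top _ _)
  rw [Measure.real, measure_pair_mem_of_indepFun hU hZ hind hS, ← h2]
  rfl

/-- The sum of the series `∑ c j * f j`, as a measurable function of `f`. -/
noncomputable def seriesLim (c : ℕ → ℝ) (f : ℕ → ℝ) : ℝ :=
  limsup (fun n => ∑ j ∈ Finset.range n, c j * f j) atTop

lemma measurable_seriesLim (c : ℕ → ℝ) : Measurable (seriesLim c) :=
  Measurable.limsup fun n => by fun_prop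

lemma seriesLim_congr {c f g : ℕ → ℝ} (h : ∀ j, c j ≠ 0 → f j = g j) :
    seriesLim c f = seriesLim c g := by
  unfold seriesLim
  congr 1
  funext n
  refine Finset.sum_congr rfl fun j _ => ?_
  by_cases hj : c j = 0
  · simp [hj]
  · rw [h j hj]

/-- Functions of series whose coefficients vanish at `0` and `h` are independent of the terms with
indices `0` and `h`. -/
lemma indepFun_seriesLim {ξ : ℕ → Ω → ℝ} (hξ : ∀ j, Measurable (ξ j)) (hind : iIndepFun ξ μ)
    {h : ℕ} {c c' : ℕ → ℝ} (hc0 : c 0 = 0) (hch : c h = 0) (hc0' : c' 0 = 0) (hch' : c' h = 0) :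
    IndepFun (fun ω => (ξ h ω, ξ 0 ω))
      (fun ω => (seriesLim c fun j => ξ j ω, seriesLim c' fun j => ξ j ω)) μ := by
  classical
  set S : Set ℕ := {0, h}
  have h1 := indepFun_of_disjoint_index hind hξ (disjoint_compl_right (a := S))
  -- Extension by zero: the series ignores the values at 0 and h, so it factors through the
  -- coordinates outside S.
  let ext : ((Sᶜ : Set ℕ) → ℝ) → ℕ → ℝ := fun g j => if hj : j ∈ Sᶜ then g ⟨j, hj⟩ else 0
  have hext : Measurable ext := by
    refine measurable_pi_lambda _ fun j => ?_
    by_cases hj : j ∈ Sᶜ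
    · simp only [ext, dif_pos hj]; fun_prop
    · simp only [ext, dif_neg hj]; fun_prop
  have h2 := h1.comp
    (φ := fun g : (S → ℝ) => (g ⟨h, by simp [S]⟩, g ⟨0, by simp [S]⟩))
    (ψ := fun g => (seriesLim c (ext g), seriesLim c' (ext g))) (by fun_prop)
    (((measurable_seriesLim c).comp hext).prodMk ((measurable_seriesLim c').comp hext))
  have hval : ∀ ω j, j ∈ Sᶜ → ξ j ω = ext (fun i => ξ i ω) j := fun ω j hj => by
    simp only [ext, dif_pos hj]
  have hser : ∀ d : ℕ → ℝ, d 0 = 0 → d h = 0 → ∀ ω,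
      seriesLim d (fun j => ξ j ω) = seriesLim d (ext fun i => ξ i ω) := by
    intro d hd0 hdh ω
    refine seriesLim_congr fun j hj => hval ω j ?_
    rintro (rfl | rfl) <;> exact hj (by assumption)
  simp_rw [hser c hc0 hch, hser c' hc0' hch']
  exact h2

end Independence

/-! ### Isolating η_0 and η_h in the log-volatilities. -/

section Decomposition

variable {Ω : Type*} [MeasurableSpace Ω] {μ : Measure Ω}
  {α : ℕ → ℝ} {η ε σ X : ℤ → Ω → ℝ} {h : ℕ}

/-- The coefficients of `log σ_h` in the variables `η_{h-j}`, without `j = 0` and `j = h`. -/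
def lateCoeff (α : ℕ → ℝ) (h j : ℕ) : ℝ := if j = 0 ∨ j = h then 0 else α j

/-- The coefficients of `log σ_0` in the variables `η_{h-j}`, without `j = h`. -/
def earlyCoeff (α : ℕ → ℝ) (h j : ℕ) : ℝ := if j ≤ h then 0 else α (j - h)

/-- The remainder `log σ_h - η_h - α_h η_0`. -/
noncomputable def lateRest (α : ℕ → ℝ) (η : ℤ → Ω → ℝ) (h : ℕ) (ω : Ω) : ℝ :=
  seriesLim (lateCoeff α h) fun j => η ((h : ℤ) - j) ω

/-- The remainder `log σ_0 - η_0`. -/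
noncomputable def earlyRest (α : ℕ → ℝ) (η : ℤ → Ω → ℝ) (h : ℕ) (ω : Ω) : ℝ :=
  seriesLim (earlyCoeff α h) fun j => η ((h : ℤ) - j) ω

lemma IsGammaTypeSVModel.alpha_zero (hmodel : IsGammaTypeSVModel μ α η ε σ X) (hα : StrictAnti α) :
    α 0 = 1 := by
  obtain ⟨i, hi⟩ := hmodel.coeff_max.1
  have h1 := hα.antitone (Nat.zero_le i)
  have h2 := (hmodel.coeff_mem 0).2
  linarith

lemma IsGammaTypeSVModel.summable (hmodel : IsGammaTypeSVModel μ α η ε σ X) : Summable α := by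
  obtain ⟨θ, hθ, hO⟩ := hmodel.coeff_decay
  exact summable_of_isBigO_nat (Real.summable_nat_rpow.2 (by linarith)) hO

lemma IsGammaTypeSVModel.measurable_lateRest (hmodel : IsGammaTypeSVModel μ α η ε σ X) (h : ℕ) :
    Measurable (lateRest α η h) :=
  (measurable_seriesLim _).comp (measurable_pi_lambda _ fun _ => hmodel.measurable_eta _)

lemma IsGammaTypeSVModel.measurable_earlyRest (hmodel : IsGammaTypeSVModel μ α η ε σ X) (h : ℕ) :
    Measurable (earlyRest α η h) :=
  (measurable_seriesLim _).comp (measurable_pi_lambda _ fun _ => hmodel.measurable_eta _)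

lemma IsGammaTypeSVModel.tendsto_late (hmodel : IsGammaTypeSVModel μ α η ε σ X)
    (hα : StrictAnti α) (hh : 1 ≤ h) : ∀ᵐ ω ∂μ,
      Tendsto (fun n => ∑ j ∈ Finset.range n, lateCoeff α h j * η ((h : ℤ) - j) ω) atTop
        (𝓝 (lateRest α η h ω)) ∧
      Real.log (σ h ω) = η h ω + α h * η 0 ω + lateRest α η h ω := by
  filter_upwards [hmodel.log_vol h] with ω hω
  have h1 : Tendsto (fun n => ∑ j ∈ Finset.range n, lateCoeff α h j * η ((h : ℤ) - j) ω) atTop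
      (𝓝 (Real.log (σ h ω) - (η h ω + α h * η 0 ω))) := by
    refine (hω.sub_const _).congr' ?_
    filter_upwards [eventually_gt_atTop h] with n hn
    have h2 : ∀ j, α j * η ((h : ℤ) - j) ω = lateCoeff α h j * η ((h : ℤ) - j) ω +
        ((if j = 0 then η h ω else 0) + (if j = h then α h * η 0 ω else 0)) := by
      intro j
      unfold lateCoeff
      by_cases hj0 : j = 0
      · subst hj0
        simp [show ¬ 0 = h by omega, hmodel.alpha_zero hα]
      · by_cases hjh : j = h
        · subst hjh
          simp [hj0]
        · simp [hj0, hjh]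
    rw [Finset.sum_congr rfl fun j _ => h2 j, Finset.sum_add_distrib, Finset.sum_add_distrib,
      Finset.sum_ite_eq', Finset.sum_ite_eq', if_pos (by simp; omega), if_pos (by simpa using hn)]
    ring
  have h3 : lateRest α η h ω = Real.log (σ h ω) - (η h ω + α h * η 0 ω) := h1.limsup_eq
  rw [h3]
  exact ⟨h1, by ring⟩

lemma IsGammaTypeSVModel.tendsto_early (hmodel : IsGammaTypeSVModel μ α η ε σ X)
    (hα : StrictAnti α) : ∀ᵐ ω ∂μ,
      Tendsto (fun n => ∑ j ∈ Finset.range n, earlyCoeff α h j * η ((h : ℤ) - j) ω) atTop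
        (𝓝 (earlyRest α η h ω)) ∧
      Real.log (σ 0 ω) = η 0 ω + earlyRest α η h ω := by
  filter_upwards [hmodel.log_vol 0] with ω hω
  have h1 : Tendsto (fun n => ∑ j ∈ Finset.range n, earlyCoeff α h j * η ((h : ℤ) - j) ω) atTop
      (𝓝 (Real.log (σ 0 ω) - η 0 ω)) := by
    -- Written in the variables η_{h-j}, the series of log σ_0 starts at j = h; the term j = h is
    -- η_0 itself and is removed.
    rw [← tendsto_add_atTop_iff_nat h]
    refine (hω.sub_const _).congr' ?_
    filter_upwards [eventually_gt_atTop 0] with n hn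
    rw [add_comm n h, Finset.sum_range_add, Finset.sum_eq_zero (s := Finset.range h), zero_add]
    · have h2 : ∀ i : ℕ, α i * η (0 - (i : ℤ)) ω =
          earlyCoeff α h (h + i) * η ((h : ℤ) - ((h + i : ℕ) : ℤ)) ω +
            (if i = 0 then η 0 ω else 0) := by
        intro i
        unfold earlyCoeff
        by_cases hi : i = 0
        · subst hi
          simp [hmodel.alpha_zero hα]
        · rw [if_neg (by omega), if_neg hi, Nat.add_sub_cancel_left]
          push_cast
          rw [show (h : ℤ) - (h + i) = 0 - i by ring, add_zero]
      rw [Finset.sum_congr rfl fun j _ => h2 j, Finset.sum_add_distrib, Finset.sum_ite_eq',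
        if_pos (by simpa using hn)]
      ring
    · intro j hj
      rw [earlyCoeff, if_pos (by have := Finset.mem_range.1 hj; omega), zero_mul]
  have h3 : earlyRest α η h ω = Real.log (σ 0 ω) - η 0 ω := h1.limsup_eq
  rw [h3]
  exact ⟨h1, by ring⟩

lemma IsGammaTypeSVModel.iIndepFun_shift (hmodel : IsGammaTypeSVModel μ α η ε σ X) (t : ℤ) :
    iIndepFun (fun j : ℕ => η (t - j)) μ :=
  hmodel.indep_eta.precomp (g := fun j : ℕ => t - (j : ℤ)) fun i j hij => by simpa using hij

lemma IsGammaTypeSVModel.indepFun_rest_eps (hmodel : IsGammaTypeSVModel μ α η ε σ X) (h : ℕ) :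
    IndepFun (fun ω => (earlyRest α η h ω, lateRest α η h ω)) (fun ω => (ε 0 ω, ε h ω)) μ := by
  refine hmodel.indep_eta_eps.comp
    (φ := fun f : ℤ → ℝ => (seriesLim (earlyCoeff α h) fun j => f ((h : ℤ) - j),
      seriesLim (lateCoeff α h) fun j => f ((h : ℤ) - j)))
    (ψ := fun f : ℤ → ℝ => (f 0, f h)) ?_ (by fun_prop)
  exact ((measurable_seriesLim _).comp (by fun_prop)).prodMk
    ((measurable_seriesLim _).comp (by fun_prop))

lemma IsGammaTypeSVModel.map_eta (hmodel : IsGammaTypeSVModel μ α η ε σ X) (t : ℤ) :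
    μ.map (η t) = μ.map (η 0) := (hmodel.identDistrib_eta t).map_eq

variable [IsProbabilityMeasure μ]

lemma IsGammaTypeSVModel.indepFun_main (hmodel : IsGammaTypeSVModel μ α η ε σ X) (h : ℕ) :
    IndepFun (fun ω => (η 0 ω, η h ω))
      (fun ω => ((earlyRest α η h ω, lateRest α η h ω), (ε 0 ω, ε h ω))) μ := by
  refine indepFun_prodMk_of_indepFun_prodMk
    ((hmodel.measurable_eta 0).prodMk (hmodel.measurable_eta h))
    ((hmodel.measurable_earlyRest h).prodMk (hmodel.measurable_lateRest h))
    ((hmodel.measurable_eps 0).prodMk (hmodel.measurable_eps h)) ?_ ?_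
  · have := indepFun_seriesLim (fun j => hmodel.measurable_eta ((h : ℤ) - j))
      (hmodel.iIndepFun_shift h) (h := h) (c := earlyCoeff α h) (c' := lateCoeff α h)
      (by simp [earlyCoeff]) (by simp [earlyCoeff]) (by simp [lateCoeff]) (by simp [lateCoeff])
    simpa [earlyRest, lateRest] using this
  · refine hmodel.indep_eta_eps.comp
      (φ := fun f : ℤ → ℝ => ((f 0, f h), (seriesLim (earlyCoeff α h) fun j => f ((h : ℤ) - j),
        seriesLim (lateCoeff α h) fun j => f ((h : ℤ) - j))))
      (ψ := fun f : ℤ → ℝ => (f 0, f h)) ?_ (by fun_prop)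
    exact (by fun_prop : Measurable fun f : ℤ → ℝ => (f 0, f h)).prodMk
      (((measurable_seriesLim _).comp (by fun_prop)).prodMk
        ((measurable_seriesLim _).comp (by fun_prop)))

lemma IsGammaTypeSVModel.map_eta_pair (hmodel : IsGammaTypeSVModel μ α η ε σ X) (hh : 1 ≤ h) :
    μ.map (fun ω => (η 0 ω, η h ω)) = (μ.map (η 0)).prod (μ.map (η 0)) := by
  have hne : (0 : ℤ) ≠ h := by omega
  rw [(hmodel.indep_eta.indepFun hne).map_prod_eq_prod_map_map
    (hmodel.measurable_eta 0).aemeasurable (hmodel.measurable_eta h).aemeasurable, hmodel.map_eta h]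

lemma IsGammaTypeSVModel.isExpTail (hmodel : IsGammaTypeSVModel μ α η ε σ X) :
    IsExpTail fun z => (μ.map (η 0)).real (Ioi z) := by
  obtain ⟨K, b, hK, -, heq⟩ := hmodel.eta_tail
  have hm0 := hmodel.measurable_eta 0
  have := Measure.isProbabilityMeasure_map (μ := μ) hm0.aemeasurable
  refine IsExpTail.of_isEquivalent (K := K) (b := b)
    (fun x y hxy => measureReal_mono (Ioi_subset_Ioi hxy)) (fun z => measureReal_le_one) hK ?_
  convert heq using 2 with z
  rw [map_measureReal_apply hm0 measurableSet_Ioi]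
  rfl

/-- The total coefficient of η_{h-j} is at most p α_1 for j < h and at most p α_{h+1} + q α_1 for j
> h. Both being below 1, all coefficients stay under one c₀ < 1 at which η has an exponential
moment. -/
lemma IsGammaTypeSVModel.lintegral_exp_rest (hmodel : IsGammaTypeSVModel μ α η ε σ X)
    (hα : StrictAnti α) (hh : 1 ≤ h) {p q : ℝ} (hp : 0 ≤ p) (hq : 0 ≤ q) (h1 : p * α 1 < 1)
    (h2 : p * α (h + 1) + q * α 1 < 1) :
    ∫⁻ ω, ENNReal.ofReal (Real.exp (q * earlyRest α η h ω + p * lateRest α η h ω)) ∂μ < ∞ := by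
  have hm0 := hmodel.measurable_eta 0
  have := Measure.isProbabilityMeasure_map (μ := μ) hm0.aemeasurable
  -- The entry 1/2 only makes c₀ positive.
  obtain ⟨c₀, hc1, hc2⟩ : ∃ c₀ : ℝ, max (1 / 2) (max (p * α 1) (p * α (h + 1) + q * α 1)) ≤ c₀ ∧
      c₀ < 1 := ⟨_, le_rfl, by simp only [max_lt_iff]; exact ⟨by norm_num, h1, h2⟩⟩
  simp only [max_le_iff] at hc1
  obtain ⟨hc3, hc4, hc5⟩ := hc1
  have hn : ∀ i, 0 ≤ α i := fun i => (hmodel.coeff_mem i).1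
  have hlate : Summable (lateCoeff α h) := by
    refine Summable.of_nonneg_of_le (fun j => ?_) (fun j => ?_) hmodel.summable
    · unfold lateCoeff; split_ifs; exacts [le_rfl, hn j]
    · unfold lateCoeff; split_ifs; exacts [hn j, le_rfl]
  have hearly : Summable (earlyCoeff α h) := by
    rw [← summable_nat_add_iff h]
    refine Summable.of_nonneg_of_le (fun j => ?_) (fun j => ?_) hmodel.summable
    · unfold earlyCoeff; split_ifs; exacts [le_rfl, hn _]
    · unfold earlyCoeff
      split_ifs
      · exact hn j
      · rw [Nat.add_sub_cancel]
  refine lintegral_exp_series_lt_top (ν := μ.map (η 0))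
    (fun j => hmodel.measurable_eta ((h : ℤ) - (j : ℕ))) (hmodel.iIndepFun_shift h)
    (fun j => hmodel.map_eta _) (by linarith : 0 < c₀)
    (lintegral_exp_lt_top hmodel.isExpTail (fun z => rfl) (by linarith) hc2).ne
    (c := fun j => q * earlyCoeff α h j + p * lateCoeff α h j) (fun j => ?_)
    ((hearly.mul_left q).add (hlate.mul_left p)) ?_
  · unfold earlyCoeff lateCoeff
    have hj := hn j
    have hjh := hn (j - h)
    by_cases hj1 : j = 0 ∨ j = h
    · rw [if_pos (by omega : j ≤ h), if_pos hj1]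
      constructor <;> linarith
    · rw [if_neg hj1]
      by_cases hj2 : j ≤ h
      · rw [if_pos hj2]
        have h3 : α j ≤ α 1 := hα.antitone (by omega)
        constructor <;> nlinarith
      · rw [if_neg hj2]
        have h3 : α j ≤ α (h + 1) := hα.antitone (by omega)
        have h4 : α (j - h) ≤ α 1 := hα.antitone (by omega)
        constructor <;> nlinarith
  · filter_upwards [hmodel.tendsto_late hα hh, hmodel.tendsto_early (h := h) hα] with ω h3 h4
    refine ((h4.1.const_mul q).add (h3.1.const_mul p)).congr fun n => ?_
    rw [Finset.mul_sum, Finset.mul_sum, ← Finset.sum_add_distrib]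
    refine Finset.sum_congr rfl fun j _ => ?_
    ring

end Decomposition

/-! ### Tail probabilities of X as integrals over the random shifts. -/

section Representation

variable {Ω : Type*} [MeasurableSpace Ω] {μ : Measure Ω} {α : ℕ → ℝ} {η ε σ X : ℤ → Ω → ℝ} {h : ℕ}

/-- The random shift of `η_0` in `log X_0`. -/
noncomputable def earlyShift (α : ℕ → ℝ) (η ε : ℤ → Ω → ℝ) (h : ℕ) (ω : Ω) : ℝ :=
  earlyRest α η h ω + Real.log (ε 0 ω)

/-- The random shift of `η_h + α_h η_0` in `log X_h`. -/
noncomputable def lateShift (α : ℕ → ℝ) (η ε : ℤ → Ω → ℝ) (h : ℕ) (ω : Ω) : ℝ :=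
  lateRest α η h ω + Real.log (ε h ω)

/-- The event that `ε_0` and `ε_h` are positive. -/
def posPair (ε : ℤ → Ω → ℝ) (h : ℕ) : Set Ω := {ω | 0 < ε 0 ω ∧ 0 < ε h ω}

/-- The event that `ε_0` is positive. -/
def posZero (ε : ℤ → Ω → ℝ) : Set Ω := {ω | 0 < ε 0 ω}

/-- `Real.log e` is not meaningful for this purpose when e ≤ 0, so positivity is a separate
conjunct; it becomes the restriction of the integrals to `posPair` and `posZero`. -/
lemma lt_mul_iff_log_lt {x s e : ℝ} (hx : 0 < x) (hs : 0 < s) :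
    x < s * e ↔ 0 < e ∧ Real.log x < Real.log s + Real.log e := by
  constructor
  · intro hlt
    have he : 0 < e := pos_of_mul_pos_right (hx.trans hlt) hs.le
    exact ⟨he, by rw [← Real.log_mul hs.ne' he.ne']; exact Real.log_lt_log hx hlt⟩
  · rintro ⟨he, hlt⟩
    rw [← Real.log_mul hs.ne' he.ne'] at hlt
    exact (Real.log_lt_log_iff hx (mul_pos hs he)).1 hlt

namespace IsGammaTypeSVModel

lemma measurable_earlyShift (hmodel : IsGammaTypeSVModel μ α η ε σ X) (h : ℕ) :
    Measurable (earlyShift α η ε h) :=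
  (hmodel.measurable_earlyRest h).add (Real.measurable_log.comp (hmodel.measurable_eps 0))

lemma measurable_lateShift (hmodel : IsGammaTypeSVModel μ α η ε σ X) (h : ℕ) :
    Measurable (lateShift α η ε h) :=
  (hmodel.measurable_lateRest h).add (Real.measurable_log.comp (hmodel.measurable_eps h))

lemma measurableSet_posZero (hmodel : IsGammaTypeSVModel μ α η ε σ X) :
    MeasurableSet (posZero ε) :=
  measurableSet_lt measurable_const (hmodel.measurable_eps 0)

lemma measurableSet_posPair (hmodel : IsGammaTypeSVModel μ α η ε σ X) (h : ℕ) :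
    MeasurableSet (posPair ε h) :=
  (measurableSet_lt measurable_const (hmodel.measurable_eps 0)).inter
    (measurableSet_lt measurable_const (hmodel.measurable_eps h))

lemma alpha_lag_mem (hmodel : IsGammaTypeSVModel μ α η ε σ X) (hα : StrictAnti α) (hh : 1 ≤ h) :
    0 < α h ∧ α h < 1 := by
  have h1 := hα (by omega : h < h + 1)
  have h2 := (hmodel.coeff_mem (h + 1)).1
  have h3 := hα (by omega : 0 < h)
  rw [hmodel.alpha_zero hα] at h3
  exact ⟨by linarith, h3⟩

lemma measure_posPair_pos (hmodel : IsGammaTypeSVModel μ α η ε σ X) (hh : 1 ≤ h) :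
    0 < μ (posPair ε h) := by
  have hne : (0 : ℤ) ≠ h := by omega
  have h1 := (hmodel.indep_eps.indepFun hne).measure_inter_preimage_eq_mul (Ioi 0) (Ioi 0)
    measurableSet_Ioi measurableSet_Ioi
  have h2 : posPair ε h = ε 0 ⁻¹' Ioi 0 ∩ ε h ⁻¹' Ioi 0 := rfl
  rw [h2, h1, (hmodel.identDistrib_eps h).measure_mem_eq measurableSet_Ioi]
  exact ENNReal.mul_pos hmodel.eps_pos.ne' hmodel.eps_pos.ne'

variable [IsProbabilityMeasure μ]

/-- Fubini, integrating first over (η_0, η_h), which is independent of the remainders and of the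
return innovations and has product law. -/
lemma joint_tail_eq (hmodel : IsGammaTypeSVModel μ α η ε σ X) (hα : StrictAnti α) (hh : 1 ≤ h)
    {x y : ℝ} (hx : 0 < x) (hy : 0 < y) :
    μ.real {ω | x < X 0 ω ∧ y < X h ω} = ∫ ω in posPair ε h,
      pairTail (μ.map (η 0)) (α h) (Real.log x - earlyShift α η ε h ω)
        (Real.log y - lateShift α η ε h ω) ∂μ := by
  have hm0 := hmodel.measurable_eta 0
  have hmh := hmodel.measurable_eta h
  have := Measure.isProbabilityMeasure_map (μ := μ) hm0.aemeasurable
  let S : Set (((ℝ × ℝ) × (ℝ × ℝ)) × (ℝ × ℝ)) := {q | (0 < q.1.2.1 ∧ 0 < q.1.2.2) ∧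
    Real.log x - (q.1.1.1 + Real.log q.1.2.1) < q.2.1 ∧
    Real.log y - (q.1.1.2 + Real.log q.1.2.2) < q.2.2 + α h * q.2.1}
  have m11 : Measurable fun q : ((ℝ × ℝ) × (ℝ × ℝ)) × (ℝ × ℝ) => q.1.1.1 := by fun_prop
  have m12 : Measurable fun q : ((ℝ × ℝ) × (ℝ × ℝ)) × (ℝ × ℝ) => q.1.1.2 := by fun_prop
  have m21 : Measurable fun q : ((ℝ × ℝ) × (ℝ × ℝ)) × (ℝ × ℝ) => q.1.2.1 := by fun_prop
  have m22 : Measurable fun q : ((ℝ × ℝ) × (ℝ × ℝ)) × (ℝ × ℝ) => q.1.2.2 := by fun_prop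
  have m31 : Measurable fun q : ((ℝ × ℝ) × (ℝ × ℝ)) × (ℝ × ℝ) => q.2.1 := by fun_prop
  have m32 : Measurable fun q : ((ℝ × ℝ) × (ℝ × ℝ)) × (ℝ × ℝ) => q.2.2 := by fun_prop
  have hS : MeasurableSet S :=
    ((measurableSet_lt measurable_const m21).inter (measurableSet_lt measurable_const m22)).inter
      ((measurableSet_lt (measurable_const.sub (m11.add m21.log)) m31).inter
        (measurableSet_lt (measurable_const.sub (m12.add m22.log)) (m32.add (m31.const_mul _))))
  have hR := ((hmodel.measurable_earlyRest h).prodMk (hmodel.measurable_lateRest h)).prodMk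
    ((hmodel.measurable_eps 0).prodMk (hmodel.measurable_eps h))
  have hU := hm0.prodMk hmh
  have key := measureReal_pair_mem_of_indepFun hU hR (hmodel.indepFun_main h) hS
  have hae : {ω | x < X 0 ω ∧ y < X h ω} =ᵐ[μ] {ω | (((earlyRest α η h ω, lateRest α η h ω),
      (ε 0 ω, ε h ω)), (η 0 ω, η h ω)) ∈ S} := by
    refine eventuallyEq_set.2 ?_
    filter_upwards [hmodel.tendsto_late hα hh, hmodel.tendsto_early (h := h) hα, hmodel.vol_pos 0,
      hmodel.vol_pos h, hmodel.return_eq 0, hmodel.return_eq h] with ω h1 h2 h3 h4 h5 h6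
    simp only [mem_ofPred_eq, S]
    rw [h5, h6, lt_mul_iff_log_lt hx h3, lt_mul_iff_log_lt hy h4, h1.2, h2.2]
    constructor
    · rintro ⟨⟨a1, a2⟩, a3, a4⟩
      exact ⟨⟨a1, a3⟩, by linarith, by linarith⟩
    · rintro ⟨⟨a1, a3⟩, a2, a4⟩
      exact ⟨⟨a1, by linarith⟩, a3, by linarith⟩
  rw [measureReal_congr hae, key, hmodel.map_eta_pair hh,
    ← integral_indicator (hmodel.measurableSet_posPair h)]
  congr 1
  funext ω
  by_cases hω : ω ∈ posPair ε h
  · rw [indicator_of_mem hω]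
    have hω' : 0 < ε 0 ω ∧ 0 < ε h ω := hω
    simp only [pairTail, S, mem_ofPred_eq, hω', earlyShift, lateShift, true_and, and_self]
  · rw [indicator_of_notMem hω]
    have hω' : ¬ (0 < ε 0 ω ∧ 0 < ε h ω) := hω
    simp only [S, mem_ofPred_eq, hω', false_and]
    simp

lemma marginal_tail_eq (hmodel : IsGammaTypeSVModel μ α η ε σ X) (hα : StrictAnti α)
    (h : ℕ) {x : ℝ} (hx : 0 < x) :
    μ.real {ω | x < X 0 ω} = ∫ ω in posZero ε,
      (μ.map (η 0)).real (Ioi (Real.log x - earlyShift α η ε h ω)) ∂μ := by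
  have hm0 := hmodel.measurable_eta 0
  have := Measure.isProbabilityMeasure_map (μ := μ) hm0.aemeasurable
  let S : Set ((ℝ × ℝ) × ℝ) := {q | 0 < q.1.2 ∧ Real.log x - (q.1.1 + Real.log q.1.2) < q.2}
  have m1 : Measurable fun q : (ℝ × ℝ) × ℝ => q.1.1 := by fun_prop
  have m2 : Measurable fun q : (ℝ × ℝ) × ℝ => q.1.2 := by fun_prop
  have m3 : Measurable fun q : (ℝ × ℝ) × ℝ => q.2 := by fun_prop
  have hS : MeasurableSet S := (measurableSet_lt measurable_const m2).inter
    (measurableSet_lt (measurable_const.sub (m1.add m2.log)) m3)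
  have hind : IndepFun (η 0) (fun ω => (earlyRest α η h ω, ε 0 ω)) μ :=
    (hmodel.indepFun_main h).comp (φ := Prod.fst)
      (ψ := fun p : (ℝ × ℝ) × (ℝ × ℝ) => (p.1.1, p.2.1)) measurable_fst (by fun_prop)
  have key := measureReal_pair_mem_of_indepFun hm0
    ((hmodel.measurable_earlyRest h).prodMk (hmodel.measurable_eps 0)) hind hS
  have hae : {ω | x < X 0 ω} =ᵐ[μ] {ω | ((earlyRest α η h ω, ε 0 ω), η 0 ω) ∈ S} := by
    refine eventuallyEq_set.2 ?_
    filter_upwards [hmodel.tendsto_early (h := h) hα, hmodel.vol_pos 0, hmodel.return_eq 0]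
      with ω h2 h3 h5
    simp only [mem_ofPred_eq, S]
    rw [h5, lt_mul_iff_log_lt hx h3, h2.2]
    refine and_congr_right fun _ => ?_
    constructor <;> intro _ <;> linarith
  rw [measureReal_congr hae, key, ← integral_indicator hmodel.measurableSet_posZero]
  congr 1
  funext ω
  by_cases hω : ω ∈ posZero ε
  · rw [indicator_of_mem hω]
    have hω' : 0 < ε 0 ω := hω
    simp only [S, mem_ofPred_eq, hω', earlyShift, true_and]
    rfl
  · rw [indicator_of_notMem hω]
    have hω' : ¬ 0 < ε 0 ω := hω
    simp only [S, mem_ofPred_eq, hω', false_and]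
    simp

end IsGammaTypeSVModel

end Representation

/-! ### Moment conditions and tail limits of the returns. -/

section TailLimits

variable {Ω : Type*} [MeasurableSpace Ω] {μ : Measure Ω} [IsProbabilityMeasure μ]
  {α : ℕ → ℝ} {η ε σ X : ℤ → Ω → ℝ} {h : ℕ}

/-- The four sign choices turn the Potter majorant into four plain exponential moments. -/
lemma exp_mul_abs_pair_le {r : ℝ} (A s t : ℝ) :
    Real.exp (A + r * (2 * |s| + |t|)) ≤
      (Real.exp (A + 2 * r * s + r * t) + Real.exp (A + 2 * r * s - r * t)) +
      (Real.exp (A - 2 * r * s + r * t) + Real.exp (A - 2 * r * s - r * t)) := by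
  have h1 := Real.exp_pos (A + 2 * r * s + r * t)
  have h2 := Real.exp_pos (A + 2 * r * s - r * t)
  have h3 := Real.exp_pos (A - 2 * r * s + r * t)
  have h4 := Real.exp_pos (A - 2 * r * s - r * t)
  rcases abs_cases s with ⟨hs, -⟩ | ⟨hs, -⟩ <;> rcases abs_cases t with ⟨ht, -⟩ | ⟨ht, -⟩ <;>
    rw [hs, ht]
  · rw [show A + r * (2 * s + t) = A + 2 * r * s + r * t by ring]; linarith
  · rw [show A + r * (2 * s + -t) = A + 2 * r * s - r * t by ring]; linarith
  · rw [show A + r * (2 * -s + t) = A - 2 * r * s + r * t by ring]; linarith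
  · rw [show A + r * (2 * -s + -t) = A - 2 * r * s - r * t by ring]; linarith

lemma exp_mul_abs_le {r : ℝ} (A t : ℝ) :
    Real.exp (A + r * |t|) ≤ Real.exp (A + r * t) + Real.exp (A - r * t) := by
  have h1 := Real.exp_pos (A + r * t)
  have h2 := Real.exp_pos (A - r * t)
  rcases abs_cases t with ⟨ht, -⟩ | ⟨ht, -⟩ <;> rw [ht]
  · linarith
  · rw [show A + r * -t = A - r * t by ring]; linarith

namespace IsGammaTypeSVModel

lemma lintegral_eps_rpow (hmodel : IsGammaTypeSVModel μ α η ε σ X) {δ : ℝ}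
    (hint : Integrable (fun ω => |ε 0 ω| ^ (1 + δ)) μ) {q : ℝ} (hq0 : 0 ≤ q) (hq : q ≤ 1 + δ)
    (t : ℤ) : ∫⁻ ω, ENNReal.ofReal ((max (ε t ω) 0) ^ q) ∂μ < ∞ := by
  have h0 : ∫⁻ ω, ENNReal.ofReal ((max (ε t ω) 0) ^ q) ∂μ =
      ∫⁻ ω, ENNReal.ofReal ((max (ε 0 ω) 0) ^ q) ∂μ :=
    ((hmodel.identDistrib_eps t).comp
      (u := fun e => ENNReal.ofReal ((max e 0) ^ q)) (by fun_prop)).lintegral_eq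
  rw [h0]
  have h1 : Integrable (fun ω => 1 + |ε 0 ω| ^ (1 + δ)) μ := (integrable_const 1).add hint
  refine lt_of_le_of_lt (lintegral_mono fun ω => ENNReal.ofReal_le_ofReal ?_) h1.lintegral_lt_top
  have h2 : max (ε 0 ω) 0 ≤ |ε 0 ω| := max_le (le_abs_self _) (abs_nonneg _)
  refine (Real.rpow_le_rpow (le_max_right _ _) h2 hq0).trans ?_
  rcases le_total |ε 0 ω| 1 with h3 | h3
  · have h4 := Real.rpow_le_one (abs_nonneg _) h3 hq0
    have h5 : 0 ≤ |ε 0 ω| ^ (1 + δ) := by positivity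
    linarith
  · have := Real.rpow_le_rpow_of_exponent_le h3 hq
    linarith

/-- The integrand factors by independence. As ε_0 and ε_h are independent, the exponents p and q do
not add up: each separately has only to stay below 1 + δ. -/
lemma lintegral_moment (hmodel : IsGammaTypeSVModel μ α η ε σ X) (hα : StrictAnti α)
    (hh : 1 ≤ h) {δ : ℝ} (hint : Integrable (fun ω => |ε 0 ω| ^ (1 + δ)) μ) {p q : ℝ}
    (hp : 0 ≤ p) (hq : 0 ≤ q) (hpδ : p ≤ 1 + δ) (hqδ : q ≤ 1 + δ) (h1 : p * α 1 < 1)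
    (h2 : p * α (h + 1) + q * α 1 < 1) :
    ∫⁻ ω, ENNReal.ofReal (Real.exp (q * earlyRest α η h ω + p * lateRest α η h ω)) *
      (ENNReal.ofReal ((max (ε 0 ω) 0) ^ q) * ENNReal.ofReal ((max (ε h ω) 0) ^ p)) ∂μ < ∞ := by
  have hne : (0 : ℤ) ≠ h := by omega
  have me := hmodel.measurable_earlyRest h
  have ml := hmodel.measurable_lateRest h
  have m0 := hmodel.measurable_eps 0
  have mh := hmodel.measurable_eps h
  have i1 : IndepFun (fun ω => ENNReal.ofReal
      (Real.exp (q * earlyRest α η h ω + p * lateRest α η h ω)))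
      (fun ω => ENNReal.ofReal ((max (ε 0 ω) 0) ^ q) * ENNReal.ofReal ((max (ε h ω) 0) ^ p)) μ :=
    (hmodel.indepFun_rest_eps h).comp
      (φ := fun s : ℝ × ℝ => ENNReal.ofReal (Real.exp (q * s.1 + p * s.2)))
      (ψ := fun e : ℝ × ℝ => ENNReal.ofReal ((max e.1 0) ^ q) * ENNReal.ofReal ((max e.2 0) ^ p))
      (by fun_prop) (by fun_prop)
  have i2 : IndepFun (fun ω => ENNReal.ofReal ((max (ε 0 ω) 0) ^ q))
      (fun ω => ENNReal.ofReal ((max (ε h ω) 0) ^ p)) μ :=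
    (hmodel.indep_eps.indepFun hne).comp
      (φ := fun e : ℝ => ENNReal.ofReal ((max e 0) ^ q))
      (ψ := fun e : ℝ => ENNReal.ofReal ((max e 0) ^ p)) (by fun_prop) (by fun_prop)
  rw [lintegral_mul_eq_lintegral_mul_lintegral_of_indepFun'' (by fun_prop) (by fun_prop) i1,
    lintegral_mul_eq_lintegral_mul_lintegral_of_indepFun'' (by fun_prop) (by fun_prop) i2]
  exact ENNReal.mul_lt_top (hmodel.lintegral_exp_rest hα hh hp hq h1 h2)
    (ENNReal.mul_lt_top (hmodel.lintegral_eps_rpow hint hq hqδ 0)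
      (hmodel.lintegral_eps_rpow hint hp hpδ h))

lemma integrable_exp_pair (hmodel : IsGammaTypeSVModel μ α η ε σ X) (hα : StrictAnti α)
    (hh : 1 ≤ h) {δ : ℝ} (hint : Integrable (fun ω => |ε 0 ω| ^ (1 + δ)) μ) {p q : ℝ}
    (hp : 0 ≤ p) (hq : 0 ≤ q) (hpδ : p ≤ 1 + δ) (hqδ : q ≤ 1 + δ) (h1 : p * α 1 < 1)
    (h2 : p * α (h + 1) + q * α 1 < 1) :
    Integrable (fun ω => Real.exp (q * earlyShift α η ε h ω + p * lateShift α η ε h ω))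
      (μ.restrict (posPair ε h)) := by
  have me := hmodel.measurable_earlyShift h
  have ml := hmodel.measurable_lateShift h
  refine ⟨by fun_prop, ?_⟩
  rw [hasFiniteIntegral_iff_ofReal (Eventually.of_forall fun ω => (Real.exp_pos _).le)]
  refine lt_of_le_of_lt ?_ (hmodel.lintegral_moment hα hh hint hp hq hpδ hqδ h1 h2)
  refine le_trans (setLIntegral_mono_ae' (hmodel.measurableSet_posPair h)
    (Eventually.of_forall fun ω hω => ?_)) (setLIntegral_le_lintegral (posPair ε h) _)
  obtain ⟨e0, eh⟩ : 0 < ε 0 ω ∧ 0 < ε h ω := hω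
  rw [max_eq_left e0.le, max_eq_left eh.le, Real.rpow_def_of_pos e0, Real.rpow_def_of_pos eh,
    ← ENNReal.ofReal_mul (Real.exp_pos _).le, ← ENNReal.ofReal_mul (Real.exp_pos _).le,
    ← Real.exp_add, ← Real.exp_add]
  refine le_of_eq ?_
  congr 2
  unfold earlyShift lateShift
  ring

lemma integrable_exp_single (hmodel : IsGammaTypeSVModel μ α η ε σ X) (hα : StrictAnti α)
    (hh : 1 ≤ h) {δ : ℝ} (hδ : 0 < δ) (hint : Integrable (fun ω => |ε 0 ω| ^ (1 + δ)) μ) {q : ℝ}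
    (hq : 0 ≤ q) (hqδ : q ≤ 1 + δ) (h2 : q * α 1 < 1) :
    Integrable (fun ω => Real.exp (q * earlyShift α η ε h ω)) (μ.restrict (posZero ε)) := by
  have me := hmodel.measurable_earlyShift h
  refine ⟨by fun_prop, ?_⟩
  rw [hasFiniteIntegral_iff_ofReal (Eventually.of_forall fun ω => (Real.exp_pos _).le)]
  refine lt_of_le_of_lt ?_ (hmodel.lintegral_moment (p := 0) hα hh hint le_rfl hq (by linarith) hqδ
    (by simp) (by simpa using h2))
  refine le_trans (setLIntegral_mono_ae' hmodel.measurableSet_posZero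
    (Eventually.of_forall fun ω hω => ?_)) (setLIntegral_le_lintegral (posZero ε) _)
  have e0 : 0 < ε 0 ω := hω
  rw [max_eq_left e0.le, Real.rpow_def_of_pos e0, Real.rpow_zero, ENNReal.ofReal_one, mul_one,
    ← ENNReal.ofReal_mul (Real.exp_pos _).le, ← Real.exp_add]
  refine le_of_eq ?_
  congr 2
  unfold earlyShift
  ring

/-- Joint tail asymptotics of `(X_0, X_h)`. -/
theorem exists_joint_tail_limit (hmodel : IsGammaTypeSVModel μ α η ε σ X) (hα : StrictAnti α)
    (hh : 1 ≤ h) : ∃ (C : ℝ) (D : ℝ → ℝ), 0 < C ∧ (∀ x, 0 < D x) ∧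
      ∀ s₀ s₁ : ℝ, 0 < s₀ → 0 < s₁ →
        Tendsto (fun x => μ.real {ω | s₀ * x < X 0 ω ∧ s₁ * x < X h ω} / D x) atTop
          (𝓝 (s₀ ^ (α h - 1) * s₁ ^ (-1 : ℝ) * C)) := by
  obtain ⟨δ, hδ, hint⟩ := hmodel.eps_moment
  obtain ⟨ha0, ha1⟩ := hmodel.alpha_lag_mem hα hh
  have hα1 : α 1 < 1 := hmodel.alpha_zero hα ▸ hα (by omega : 0 < 1)
  have hα1' : 0 ≤ α 1 := (hmodel.coeff_mem 1).1
  have hαh : α (h + 1) < α h := hα (by omega)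
  have hαh' : 0 ≤ α (h + 1) := (hmodel.coeff_mem (h + 1)).1
  -- For p within r of 1 and q within 2r of 1 - α_h, the four bounds on r give in turn: p, q ≤ 1 +
  -- δ; q ≥ 0 and a positive Potter rate; p α_1 < 1; p α_{h+1} + q α_1 < 1.
  obtain ⟨r, hr, hr1, hr2, hr3, hr4⟩ : ∃ r : ℝ, 0 < r ∧ r ≤ δ / 2 ∧ r ≤ (1 - α h) / 4 ∧
      r ≤ (1 - α 1) / 2 ∧ r ≤ (α h - α (h + 1)) / 4 := by
    refine ⟨min (min (δ / 2) ((1 - α h) / 4)) (min ((1 - α 1) / 2) ((α h - α (h + 1)) / 4)), ?_,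
      (min_le_left _ _).trans (min_le_left _ _), (min_le_left _ _).trans (min_le_right _ _),
      (min_le_right _ _).trans (min_le_left _ _), (min_le_right _ _).trans (min_le_right _ _)⟩
    refine lt_min (lt_min ?_ ?_) (lt_min ?_ ?_) <;> linarith
  have hm0 := hmodel.measurable_eta 0
  have := Measure.isProbabilityMeasure_map (μ := μ) hm0.aemeasurable
  have me := hmodel.measurable_earlyShift h
  have ml := hmodel.measurable_lateShift h
  have hI : ∀ p q : ℝ, 1 - r ≤ p → p ≤ 1 + r → 1 - α h - 2 * r ≤ q → q ≤ 1 - α h + 2 * r →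
      Integrable (fun ω => Real.exp (q * earlyShift α η ε h ω + p * lateShift α η ε h ω))
        (μ.restrict (posPair ε h)) := by
    intro p q hp1 hp2 hq1 hq2
    refine hmodel.integrable_exp_pair hα hh hint (by linarith) (by linarith) (by linarith)
      (by linarith) (by nlinarith) (by nlinarith)
  have hdom : Integrable (fun ω => Real.exp ((1 - α h) * earlyShift α η ε h ω +
      lateShift α η ε h ω + r * (2 * |earlyShift α η ε h ω| + |lateShift α η ε h ω|)))
      (μ.restrict (posPair ε h)) := by
    have i1 := hI (1 + r) (1 - α h + 2 * r) (by linarith) (by linarith) (by linarith) (by linarith)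
    have i2 := hI (1 - r) (1 - α h + 2 * r) (by linarith) (by linarith) (by linarith) (by linarith)
    have i3 := hI (1 + r) (1 - α h - 2 * r) (by linarith) (by linarith) (by linarith) (by linarith)
    have i4 := hI (1 - r) (1 - α h - 2 * r) (by linarith) (by linarith) (by linarith) (by linarith)
    refine ((i1.add i2).add (i3.add i4)).mono' (by fun_prop) (Eventually.of_forall fun ω => ?_)
    rw [Real.norm_of_nonneg (Real.exp_pos _).le]
    refine (exp_mul_abs_pair_le _ _ _).trans_eq ?_
    simp only [Pi.add_apply]
    congr 1 <;> congr 1 <;> (congr 1; ring)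
  have hpos : 0 < ∫ ω in posPair ε h,
      Real.exp ((1 - α h) * earlyShift α η ε h ω + lateShift α η ε h ω) ∂μ := by
    have i0 := hI 1 (1 - α h) (by linarith) (by linarith) (by linarith) (by linarith)
    simp only [one_mul] at i0
    have : NeZero (μ.restrict (posPair ε h)) :=
      ⟨by simpa using (hmodel.measure_posPair_pos hh).ne'⟩
    exact integral_exp_pos i0
  set m : ℝ → ℝ := fun z => (μ.map (η 0)).real (Ioi z) with hm
  have htail : IsExpTail m := hmodel.isExpTail
  refine ⟨_, fun x => m (Real.log x) * m ((1 - α h) * Real.log x),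
    div_pos hpos (by linarith : 0 < 1 - α h), fun x => mul_pos (htail.pos _) (htail.pos _),
    fun s₀ s₁ hs₀ hs₁ => ?_⟩
  have hlim := (tendsto_integral_pairTail htail (fun z => rfl) ha0 ha1 hr (by nlinarith) me ml hdom
    (Real.log s₀) (Real.log s₁)).comp Real.tendsto_log_atTop
  have e : Real.exp (-(1 - α h) * Real.log s₀ - Real.log s₁) =
      s₀ ^ (α h - 1) * s₁ ^ (-1 : ℝ) := by
    rw [Real.rpow_def_of_pos hs₀, Real.rpow_def_of_pos hs₁, ← Real.exp_add]
    congr 1; ring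
  rw [e] at hlim
  refine hlim.congr' ?_
  filter_upwards [eventually_gt_atTop 0] with x hx
  rw [hmodel.joint_tail_eq hα hh (mul_pos hs₀ hx) (mul_pos hs₁ hx),
    Real.log_mul hs₀.ne' hx.ne', Real.log_mul hs₁.ne' hx.ne', add_comm (Real.log s₀),
    add_comm (Real.log s₁)]
  rfl

/-- Marginal tail asymptotics of `X_0`. -/
theorem exists_marginal_tail_limit (hmodel : IsGammaTypeSVModel μ α η ε σ X) (hα : StrictAnti α) :
    ∃ (C : ℝ) (D : ℝ → ℝ), 0 < C ∧ (∀ x, 0 < D x) ∧ ∀ s : ℝ, 0 < s →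
        Tendsto (fun x => μ.real {ω | s * x < X 0 ω} / D x) atTop (𝓝 (s⁻¹ * C)) := by
  obtain ⟨δ, hδ, hint⟩ := hmodel.eps_moment
  have hα1 : α 1 < 1 := hmodel.alpha_zero hα ▸ hα (by omega : 0 < 1)
  have hα1' : 0 ≤ α 1 := (hmodel.coeff_mem 1).1
  obtain ⟨r, hr, hr1, hr2⟩ : ∃ r : ℝ, 0 < r ∧ r ≤ δ ∧ r ≤ (1 - α 1) / 2 := by
    refine ⟨min δ ((1 - α 1) / 2), lt_min hδ (by linarith), min_le_left _ _, min_le_right _ _⟩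
  have hm0 := hmodel.measurable_eta 0
  have := Measure.isProbabilityMeasure_map (μ := μ) hm0.aemeasurable
  -- The lag only affects the indexing of the remainder of log σ_0, so 1 serves as well as any
  -- other.
  have me := hmodel.measurable_earlyShift 1
  have hI : ∀ q : ℝ, 1 - r ≤ q → q ≤ 1 + r →
      Integrable (fun ω => Real.exp (q * earlyShift α η ε 1 ω)) (μ.restrict (posZero ε)) := by
    intro q hq1 hq2
    exact hmodel.integrable_exp_single hα le_rfl hδ hint (by linarith) (by linarith)
      (by nlinarith)
  have hdom : Integrable (fun ω => Real.exp (earlyShift α η ε 1 ω + r * |earlyShift α η ε 1 ω|))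
      (μ.restrict (posZero ε)) := by
    refine ((hI (1 + r) (by linarith) le_rfl).add (hI (1 - r) le_rfl (by linarith))).mono'
      (by fun_prop) (Eventually.of_forall fun ω => ?_)
    rw [Real.norm_of_nonneg (Real.exp_pos _).le]
    refine (exp_mul_abs_le _ _).trans_eq ?_
    simp only [Pi.add_apply]
    congr 2 <;> ring
  have hpos : 0 < ∫ ω in posZero ε, Real.exp (earlyShift α η ε 1 ω) ∂μ := by
    have i0 := hI 1 (by linarith) (by linarith)
    simp only [one_mul] at i0
    have : NeZero (μ.restrict (posZero ε)) := ⟨by simpa [posZero] using hmodel.eps_pos.ne'⟩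
    exact integral_exp_pos i0
  set m : ℝ → ℝ := fun z => (μ.map (η 0)).real (Ioi z) with hm
  have htail : IsExpTail m := hmodel.isExpTail
  refine ⟨_, fun x => m (Real.log x), hpos, fun x => htail.pos _, fun s hs => ?_⟩
  have hlim := (tendsto_integral_tail htail hr me hdom (Real.log s)).comp Real.tendsto_log_atTop
  rw [Real.exp_neg, Real.exp_log hs] at hlim
  refine hlim.congr' ?_
  filter_upwards [eventually_gt_atTop 0] with x hx
  rw [hmodel.marginal_tail_eq hα 1 (mul_pos hs hx), Real.log_mul hs.ne' hx.ne',
    add_comm (Real.log s)]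
  rfl

end IsGammaTypeSVModel

end TailLimits

/-! ### Quantiles of a law with tail of index -1. -/

section Quantile

variable {ν : Measure ℝ}

lemma quantileSet_nonempty {x : ℝ} (hx : 0 < x) : {y : ℝ | 1 - 1 / x ≤ cdf ν y}.Nonempty := by
  have h1 : 1 - 1 / x < 1 := by have := one_div_pos.2 hx; linarith
  obtain ⟨y, hy⟩ := ((tendsto_cdf_atTop ν).eventually (lt_mem_nhds h1)).exists
  exact ⟨y, hy.le⟩

lemma quantileSet_bddBelow {x : ℝ} (hx : 1 < x) : BddBelow {y : ℝ | 1 - 1 / x ≤ cdf ν y} := by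
  have h1 : 0 < 1 - 1 / x := by
    rw [sub_pos, div_lt_one (by linarith)]; exact hx
  obtain ⟨w, hw⟩ := ((tendsto_cdf_atBot ν).eventually (gt_mem_nhds h1)).exists
  refine ⟨w, fun y hy => ?_⟩
  by_contra hlt
  exact absurd (monotone_cdf ν (not_le.1 hlt).le) (not_le.2 (hw.trans_le hy))

lemma monotoneOn_quantile : MonotoneOn (fun x => quantile ν (1 - 1 / x)) (Ioi 1) := by
  intro x hx y hy hxy
  have hx' : (1 : ℝ) < x := hx
  refine csInf_le_csInf (quantileSet_bddBelow hx) (quantileSet_nonempty (by linarith)) ?_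
  intro w hw
  have : 1 / y ≤ 1 / x := one_div_le_one_div_of_le (by linarith) hxy
  have hw' : 1 - 1 / y ≤ cdf ν w := hw
  change 1 - 1 / x ≤ cdf ν w
  linarith

variable {C : ℝ} {D : ℝ → ℝ}

lemma tendsto_tail_ratio (hC : 0 < C) (hD : ∀ x, 0 < D x) (hlim : ∀ s : ℝ, 0 < s →
      Tendsto (fun x => ν.real (Ioi (s * x)) / D x) atTop (𝓝 (s⁻¹ * C))) {s t : ℝ} (hs : 0 < s)
    (ht : 0 < t) :
    Tendsto (fun x => ν.real (Ioi (s * x)) / ν.real (Ioi (t * x))) atTop (𝓝 (t / s)) := by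
  have h1 := (hlim s hs).div (hlim t ht) (by positivity)
  have e : s⁻¹ * C / (t⁻¹ * C) = t / s := by field_simp
  rw [e] at h1
  refine h1.congr fun x => ?_
  exact div_div_div_cancel_right₀ (hD x).ne' _ _

variable [IsProbabilityMeasure ν]

lemma le_cdf_iff_tail_le {x y : ℝ} : 1 - 1 / x ≤ cdf ν y ↔ ν.real (Ioi y) ≤ 1 / x := by
  rw [cdf_eq_real, ← compl_Iic, probReal_compl_eq_one_sub measurableSet_Iic]
  constructor <;> intro _ <;> linarith

lemma tail_le_of_quantile_lt {x y : ℝ} (hx : 0 < x) (h : quantile ν (1 - 1 / x) < y) :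
    ν.real (Ioi y) ≤ 1 / x := by
  obtain ⟨w, hw, hwy⟩ := exists_lt_of_csInf_lt (quantileSet_nonempty hx) h
  exact (measureReal_mono (Ioi_subset_Ioi hwy.le)).trans (le_cdf_iff_tail_le.1 hw)

lemma lt_tail_of_lt_quantile {x y : ℝ} (hx : 1 < x) (h : y < quantile ν (1 - 1 / x)) :
    1 / x < ν.real (Ioi y) := by
  by_contra hle
  exact notMem_of_lt_csInf h (quantileSet_bddBelow hx) (le_cdf_iff_tail_le.2 (not_lt.1 hle))

lemma tendsto_quantile_atTop (hpos : ∀ y, 0 < ν.real (Ioi y)) :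
    Tendsto (fun x => quantile ν (1 - 1 / x)) atTop atTop := by
  refine tendsto_atTop.2 fun y => ?_
  filter_upwards [eventually_gt_atTop 0, eventually_gt_atTop (1 / ν.real (Ioi (y - 1 + 1)))]
    with x hx0 hx
  by_contra hlt
  rw [sub_add_cancel, div_lt_iff₀ (hpos y)] at hx
  have := tail_le_of_quantile_lt hx0 (not_le.1 hlt)
  rw [le_div_iff₀ hx0] at this
  linarith

lemma tail_pos (hC : 0 < C) (hD : ∀ x, 0 < D x) (hlim : ∀ s : ℝ, 0 < s →
      Tendsto (fun x => ν.real (Ioi (s * x)) / D x) atTop (𝓝 (s⁻¹ * C))) (y : ℝ) :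
    0 < ν.real (Ioi y) := by
  have h1 := hlim 1 one_pos
  have h2 : (0 : ℝ) < 1⁻¹ * C := by simpa using hC
  obtain ⟨x, hx1, hx2⟩ := ((h1.eventually (lt_mem_nhds h2)).and (eventually_ge_atTop y)).exists
  rw [lt_div_iff₀ (hD x), zero_mul, one_mul] at hx1
  exact hx1.trans_le (measureReal_mono (Ioi_subset_Ioi hx2))

/-- Write Q for the quantile at 1 - 1/x and pick 1 < t < l / s. If the bound failed, the tail would
exceed 1/(s x) at l Q and be at most 1/x at t Q, while the ratio of these tails tends to t / l < 1 /
s. The margin t handles possible jumps at Q. -/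
lemma eventually_quantile_le (hC : 0 < C) (hD : ∀ x, 0 < D x) (hlim : ∀ s : ℝ, 0 < s →
      Tendsto (fun x => ν.real (Ioi (s * x)) / D x) atTop (𝓝 (s⁻¹ * C))) {s l : ℝ} (hs : 0 < s)
    (hl : s < l) :
    ∀ᶠ x in atTop, quantile ν (1 - 1 / (s * x)) ≤ l * quantile ν (1 - 1 / x) := by
  have hpos := tail_pos hC hD hlim
  obtain ⟨t, ht1, ht2⟩ : ∃ t : ℝ, 1 < t ∧ t < l / s :=
    exists_between ((one_lt_div hs).2 hl)
  have hb := tendsto_quantile_atTop hpos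
  have h1 : t / l < 1 / s := by
    rw [div_lt_div_iff₀ (by linarith) hs]
    rw [lt_div_iff₀ hs] at ht2
    linarith
  have h2 := hb.eventually ((tendsto_tail_ratio hC hD hlim (by linarith : 0 < l)
    (by linarith : 0 < t)).eventually (gt_mem_nhds h1))
  filter_upwards [h2, hb.eventually (eventually_gt_atTop 0), eventually_gt_atTop 0,
    eventually_gt_atTop (1 / s)] with x hx1 hx2 hx3 hx4
  by_contra hlt
  have hsx : 1 < s * x := by
    rw [div_lt_iff₀ hs] at hx4; linarith
  have h3 := lt_tail_of_lt_quantile hsx (not_le.1 hlt)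
  have h4 : ν.real (Ioi (t * quantile ν (1 - 1 / x))) ≤ 1 / x :=
    tail_le_of_quantile_lt hx3 (by nlinarith)
  rw [div_lt_iff₀ (hpos _)] at hx1
  have h5 : 1 / s * ν.real (Ioi (t * quantile ν (1 - 1 / x))) ≤ 1 / s * (1 / x) := by gcongr
  rw [one_div_mul_one_div] at h5
  linarith

lemma eventually_le_quantile (hC : 0 < C) (hD : ∀ x, 0 < D x) (hlim : ∀ s : ℝ, 0 < s →
      Tendsto (fun x => ν.real (Ioi (s * x)) / D x) atTop (𝓝 (s⁻¹ * C))) {s l : ℝ} (hl0 : 0 < l)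
    (hl : l < s) :
    ∀ᶠ x in atTop, l * quantile ν (1 - 1 / x) ≤ quantile ν (1 - 1 / (s * x)) := by
  have hpos := tail_pos hC hD hlim
  have hs : 0 < s := hl0.trans hl
  obtain ⟨t, ht1, ht2⟩ : ∃ t : ℝ, l / s < t ∧ t < 1 := exists_between ((div_lt_one hs).2 hl)
  have ht0 : 0 < t := (div_pos hl0 hs).trans ht1
  have hb := tendsto_quantile_atTop hpos
  have h1 : 1 / s < t / l := by
    rw [div_lt_div_iff₀ hs hl0]
    rw [div_lt_iff₀ hs] at ht1
    linarith
  have h2 := hb.eventually ((tendsto_tail_ratio hC hD hlim hl0 ht0).eventually (lt_mem_nhds h1))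
  filter_upwards [h2, hb.eventually (eventually_gt_atTop 0), eventually_gt_atTop 1]
    with x hx1 hx2 hx3
  by_contra hlt
  have h3 : ν.real (Ioi (l * quantile ν (1 - 1 / x))) ≤ 1 / (s * x) :=
    tail_le_of_quantile_lt (by positivity) (not_le.1 hlt)
  have h4 : 1 / x < ν.real (Ioi (t * quantile ν (1 - 1 / x))) :=
    lt_tail_of_lt_quantile hx3 (by nlinarith)
  rw [lt_div_iff₀ (hpos _)] at hx1
  have h5 : 1 / s * (1 / x) < 1 / s * ν.real (Ioi (t * quantile ν (1 - 1 / x))) := by gcongr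
  rw [one_div_mul_one_div] at h5
  linarith

/-- A positive nonincreasing regularly varying function, composed with the quantile function of a
law whose tail is regularly varying with index `-1`, is regularly varying with the same index. -/
theorem regularlyVarying_comp_quantile (hC : 0 < C) (hD : ∀ x, 0 < D x) (hlim : ∀ s : ℝ, 0 < s →
      Tendsto (fun x => ν.real (Ioi (s * x)) / D x) atTop (𝓝 (s⁻¹ * C))) {G : ℝ → ℝ} {k : ℝ}
    (hG : Antitone G) (hGpos : ∀ x, 0 < G x)
    (hGlim : ∀ s : ℝ, 0 < s → Tendsto (fun x => G (s * x) / G x) atTop (𝓝 (s ^ k))) :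
    RegularlyVarying (fun x => G (quantile ν (1 - 1 / x))) k := by
  have hb := tendsto_quantile_atTop (tail_pos hC hD hlim)
  refine ⟨⟨1, ?_, fun x _ => hGpos _⟩, fun s hs => ?_⟩
  · refine Antitone.measurable fun x y hxy => ?_
    exact hG (monotoneOn_quantile x.2 y.2 hxy)
  have hcont : Tendsto (fun l : ℝ => l ^ k) (𝓝 s) (𝓝 (s ^ k)) :=
    (Real.continuousAt_rpow_const s k (Or.inl hs.ne')).tendsto
  refine tendsto_order.2 ⟨fun c hc => ?_, fun c hc => ?_⟩
  -- As G is nonincreasing, an upper bound l Q on the quantile, with l slightly above s, bounds G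
  -- from below; the other half takes l slightly below s.
  · obtain ⟨l, hl1, hl2⟩ := (((hcont.mono_left nhdsWithin_le_nhds).eventually
      (lt_mem_nhds hc)).and (self_mem_nhdsWithin : Ioi s ∈ 𝓝[>] s)).exists
    have hl0 : 0 < l := hs.trans hl2
    filter_upwards [hb.eventually ((hGlim l hl0).eventually (lt_mem_nhds hl1)),
      eventually_quantile_le hC hD hlim hs hl2] with x h1 h2
    exact h1.trans_le (div_le_div_of_nonneg_right (hG h2) (hGpos _).le)
  · obtain ⟨l, ⟨hl1, hl0⟩, hl2⟩ := ((((hcont.mono_left nhdsWithin_le_nhds).eventually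
      (gt_mem_nhds hc)).and ((lt_mem_nhds hs).filter_mono nhdsWithin_le_nhds)).and
      (self_mem_nhdsWithin : Iio s ∈ 𝓝[<] s)).exists
    filter_upwards [hb.eventually ((hGlim l hl0).eventually (gt_mem_nhds hl1)),
      eventually_le_quantile hC hD hlim hl0 hl2] with x h1 h2
    exact (div_le_div_of_nonneg_right (hG h2) (hGpos _).le).trans_lt h1

end Quantile

/-! ### Stationarity, volatilities as returns, and tail dependence. -/

section TailDependence

variable {Ω : Type*} [MeasurableSpace Ω] {μ : Measure Ω}
  {α : ℕ → ℝ} {η ε σ X : ℤ → Ω → ℝ} {h : ℕ}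

namespace IsGammaTypeSVModel

lemma ae_eq_return (hmodel : IsGammaTypeSVModel μ α η ε σ X) (t : ℤ) :
    X t =ᵐ[μ] fun ω => Real.exp (seriesLim α fun j => η (t - (j : ℤ)) ω) * ε t ω := by
  filter_upwards [hmodel.log_vol t, hmodel.vol_pos t, hmodel.return_eq t] with ω h1 h2 h3
  have h4 : (seriesLim α fun j => η (t - (j : ℤ)) ω) = Real.log (σ t ω) := h1.limsup_eq
  rw [h3, h4, Real.exp_log h2]

variable [IsProbabilityMeasure μ]

/-- The returns are identically distributed. -/
lemma identDistrib_return (hmodel : IsGammaTypeSVModel μ α η ε σ X) (t : ℤ) :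
    IdentDistrib (X t) (X 0) μ μ := by
  have hη : ∀ t : ℤ, Measurable fun ω => fun j : ℕ => η (t - (j : ℤ)) ω := fun t =>
    measurable_pi_lambda _ fun j => hmodel.measurable_eta _
  have hind : ∀ t : ℤ, IndepFun (fun ω => fun j : ℕ => η (t - (j : ℤ)) ω) (ε t) μ := fun t =>
    hmodel.indep_eta_eps.comp (φ := fun f : ℤ → ℝ => fun j : ℕ => f (t - (j : ℤ)))
      (ψ := fun f : ℤ → ℝ => f t) (by fun_prop) (by fun_prop)
  have h1 : IdentDistrib (fun ω => fun j : ℕ => η (t - (j : ℤ)) ω)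
      (fun ω => fun j : ℕ => η (0 - (j : ℤ)) ω) μ μ :=
    IdentDistrib.pi (fun j => (hmodel.identDistrib_eta _).trans (hmodel.identDistrib_eta _).symm)
      (hmodel.iIndepFun_shift t) (hmodel.iIndepFun_shift 0)
  have h2 := (h1.prodMk (hmodel.identDistrib_eps t) (hind t) (hind 0)).comp
    (u := fun p : (ℕ → ℝ) × ℝ => Real.exp (seriesLim α p.1) * p.2)
    ((Real.measurable_exp.comp ((measurable_seriesLim α).comp measurable_fst)).mul measurable_snd)
  have h3 : ∀ t : ℤ, AEMeasurable
      (fun ω => Real.exp (seriesLim α fun j => η (t - (j : ℤ)) ω) * ε t ω) μ := fun t =>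
    ((Real.measurable_exp.comp ((measurable_seriesLim α).comp (hη t))).mul
      (hmodel.measurable_eps t)).aemeasurable
  exact ((IdentDistrib.of_ae_eq (h3 t) (hmodel.ae_eq_return t).symm).symm.trans h2).trans
    (IdentDistrib.of_ae_eq (h3 0) (hmodel.ae_eq_return 0).symm)

/-- The volatilities form a model of the same type, with constant return innovations. -/
lemma volatility (hmodel : IsGammaTypeSVModel μ α η ε σ X) :
    IsGammaTypeSVModel μ α η (fun _ _ => 1) σ σ where
  coeff_mem := hmodel.coeff_mem
  coeff_max := hmodel.coeff_max
  coeff_decay := hmodel.coeff_decay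
  measurable_eta := hmodel.measurable_eta
  indep_eta := hmodel.indep_eta
  identDistrib_eta := hmodel.identDistrib_eta
  eta_sq := hmodel.eta_sq
  eta_tail := hmodel.eta_tail
  measurable_eps := fun _ => measurable_const
  indep_eps := by
    -- Constants are independent: a Dirac measure on the product space is the product of Dirac
    -- measures.
    rw [iIndepFun_iff_map_fun_eq_infinitePi_map fun _ => measurable_const]
    simp only [Measure.map_const, measure_univ, one_smul]
    rw [Measure.infinitePi_dirac]
  identDistrib_eps := fun _ => IdentDistrib.refl aemeasurable_const
  eps_pos := by simp
  eps_moment := ⟨1, one_pos, by simp⟩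
  indep_eta_eps := indepFun_const_right _ _
  vol_pos := hmodel.vol_pos
  log_vol := hmodel.log_vol
  return_eq := fun t => Eventually.of_forall fun ω => (mul_one _).symm

/-- The limit of the conditional joint exceedance probabilities of `(X_0, X_h)`. -/
theorem tendsto_joint_exceedance (hmodel : IsGammaTypeSVModel μ α η ε σ X) (hα : StrictAnti α)
    (hh : 1 ≤ h) {s₀ s₁ : ℝ} (hs₀ : 0 < s₀) (hs₁ : 0 < s₁) :
    Tendsto (fun x : ℝ => μ.real {ω | s₀ * x < X 0 ω ∧ s₁ * x < X h ω} /
      μ.real {ω | x < X 0 ω ∧ x < X h ω}) atTop (𝓝 (s₀ ^ (α h - 1) * s₁ ^ (-1 : ℝ))) := by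
  obtain ⟨C, D, hC, hD, hlim⟩ := hmodel.exists_joint_tail_limit hα hh
  have h1 := hlim 1 1 one_pos one_pos
  simp only [one_mul, Real.one_rpow] at h1
  have h2 := (hlim s₀ s₁ hs₀ hs₁).div h1 hC.ne'
  rw [mul_div_cancel_right₀ _ hC.ne'] at h2
  exact h2.congr fun x => div_div_div_cancel_right₀ (hD x).ne' _ _

/-- The coefficient of tail dependence of `(X_0, X_h)`. -/
theorem hasTailDependenceCoeff (hmodel : IsGammaTypeSVModel μ α η ε σ X) (hα : StrictAnti α)
    (hh : 1 ≤ h) : HasTailDependenceCoeff μ (X 0) (X h) (1 / (2 - α h)) := by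
  obtain ⟨ha0, ha1⟩ := hmodel.alpha_lag_mem hα hh
  refine ⟨one_div_pos.2 (by linarith), (hmodel.identDistrib_return h).symm, ?_⟩
  have hXm : AEMeasurable (X 0) μ := (hmodel.identDistrib_return 0).aemeasurable_fst
  have := Measure.isProbabilityMeasure_map (μ := μ) hXm
  obtain ⟨C, D, hC, hD, hlim⟩ := hmodel.exists_marginal_tail_limit hα
  obtain ⟨C', D', hC', hD', hlim'⟩ := hmodel.exists_joint_tail_limit hα hh
  have hanti : Antitone fun y : ℝ => μ.real {ω | y < X 0 ω ∧ y < X h ω} := fun x y hxy =>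
    measureReal_mono fun ω hω => ⟨hxy.trans_lt hω.1, hxy.trans_lt hω.2⟩
  rw [one_div_one_div]
  refine regularlyVarying_comp_quantile (ν := μ.map (X 0)) hC hD (fun s hs => ?_)
    (G := fun y => μ.real {ω | y < X 0 ω ∧ y < X h ω}) hanti (fun y => ?_) fun s hs => ?_
  · refine (hlim s hs).congr fun x => ?_
    rw [map_measureReal_apply_of_aemeasurable hXm measurableSet_Ioi]
    rfl
  -- A positive limit makes the joint tail positive at some arbitrarily high level, and monotonicity
  -- makes it positive at every lower one.
  · have h1 := hlim' 1 1 one_pos one_pos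
    simp only [one_mul, Real.one_rpow] at h1
    obtain ⟨x, hx1, hx2⟩ := ((h1.eventually (lt_mem_nhds hC')).and (eventually_ge_atTop y)).exists
    rw [lt_div_iff₀ (hD' x), zero_mul] at hx1
    exact hx1.trans_le (hanti hx2)
  · have e : s ^ (α h - 1) * s ^ (-1 : ℝ) = s ^ (-(2 - α h)) := by
      rw [← Real.rpow_add hs]
      congr 1; ring
    rw [← e]
    exact hmodel.tendsto_joint_exceedance hα hh hs hs

end IsGammaTypeSVModel

end TailDependence

theorem mainTheorem6 {Ω : Type*} [MeasurableSpace Ω] (μ : Measure Ω) [IsProbabilityMeasure μ]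
    (α : ℕ → ℝ) (η ε σ X : ℤ → Ω → ℝ) (hmodel : IsGammaTypeSVModel μ α η ε σ X)
    (hα : StrictAnti α) (h : ℕ) (hh : 1 ≤ h) :
    α 0 = 1 ∧
    (∀ κ : ℕ → ℝ, IsLagLPSolution α h κ ↔
      κ = fun i => if i = 0 then 1 - α h else if i = h then 1 else 0) ∧
    ((∃ δ : ℝ, 0 < δ ∧ Integrable (fun ω => (max (ε 0 ω) 0) ^ (2 - α h + δ)) μ) →
      (∀ s₀ sₕ : ℝ, 0 < s₀ → 0 < sₕ →
        Tendsto (fun x : ℝ =>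
            μ.real {ω | s₀ * x < σ 0 ω ∧ sₕ * x < σ (h : ℤ) ω} /
              μ.real {ω | x < min (σ 0 ω) (σ (h : ℤ) ω)})
          atTop (𝓝 (s₀ ^ (α h - 1) * sₕ ^ (-1 : ℝ))) ∧
        Tendsto (fun x : ℝ =>
            μ.real {ω | s₀ * x < X 0 ω ∧ sₕ * x < X (h : ℤ) ω} /
              μ.real {ω | x < min (X 0 ω) (X (h : ℤ) ω)})
          atTop (𝓝 (s₀ ^ (α h - 1) * sₕ ^ (-1 : ℝ)))) ∧
      HasTailDependenceCoeff μ (σ 0) (σ (h : ℤ)) (1 / (2 - α h)) ∧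
      HasTailDependenceCoeff μ (X 0) (X (h : ℤ)) (1 / (2 - α h))) := by
  -- The moment bound `E|ε_0|^(1+δ) < ∞` of the model suffices for the limits.
  have h0 := hmodel.alpha_zero hα
  refine ⟨h0, fun κ => isLagLPSolution_iff hα hmodel.coeff_mem h0 hh κ, fun _ => ⟨?_, ?_, ?_⟩⟩
  · intro s₀ sₕ hs₀ hsₕ
    simp only [lt_min_iff]
    exact ⟨hmodel.volatility.tendsto_joint_exceedance hα hh hs₀ hsₕ,
      hmodel.tendsto_joint_exceedance hα hh hs₀ hsₕ⟩
  · exact hmodel.volatility.hasTailDependenceCoeff hα hh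
  · exact hmodel.hasTailDependenceCoeff hα hh
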